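/- Consider the discrete-time quantum walk on $\ell^2(\mathbb Z)\otimes\mathbb C^2$ with one step $U_\Theta=S(\mathbb 1\otimes C_{\theta,\alpha,\beta})$, where $S=\sum_x |x+1\rangle\langle x|\otimes|0\rangle\langle 0|+|x-1\rangle\langle x|\otimes|1\rangle\langle 1|$ and $C_{\theta,\alpha,\beta}=\begin{pmatrix}e^{i\alpha}\cos\theta & e^{i\beta}\sin\theta\\ -e^{-i\beta}\sin\theta & e^{-i\alpha}\cos\theta\end{pmatrix}$, $\sin\theta\neq 0$. The unknown parameters are $\Theta=(\theta,\alpha)$ and $\beta$ is fixed. For an initial state $\Psi$ put $\varrho(t)=|\Psi_\Theta(t)\rangle\langle\Psi_\Theta(t)|$ with $\Psi_\Theta(t)=U_\Theta^t\Psi$. Let $F_{\mu\nu}(t)=\frac12\mathrm{Tr}(\varrho(t)\{L_\mu,L_\nu\})$ be its quantum Fisher information (QFI) matrix and $\mathcal U_{\mu\nu}(t)=-\frac i2\mathrm{Tr}(\varrho(t)[L_\mu,L_\nu])$ its Uhlmann curvature, where $L_\mu$ is the symmetric logarithmic derivative (self-adjoint with $\partial_\mu\varrho=\frac12\{L_\mu,\varrho\}$).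 Let $\varphi_k=\sum_{x,j}e^{-ikx}\Psi_{x,j}|j\rangle$ and $\varrho_0(k)=|\varphi_k\rangle\langle\varphi_k|$. Call $\Psi$ a probe if $\mathrm{Tr}\,\varrho_0(k)=1$ for almost every $k$. Let $u_k=(e^{-ik}|0\rangle\langle0|+e^{ik}|1\rangle\langle1|)C_{\theta,\alpha,\beta}$ and $O_\mu=u_k^\dagger\partial_\mu u_k$. For a $2\times2$ matrix $O$ let $|O))=(\mathrm{Tr}(O\sigma_i))_{i=0,x,y,z}$ with $\sigma_0=\mathbb 1$. Finally let $$\mathcal A_k^{\mathbb 1}=N\begin{pmatrix}1/N&0&0&0\\0&s^2&-cs&ds\\0&-cs&c^2&-dc\\0&ds&-dc&d^2\end{pmatrix},$$ with $s=\sin(k-\beta)$, $c=\cos(k-\beta)$, $d=\cot\theta\,\sin(k-\alpha)$ and $N=\frac{\sin^2\theta}{1-\cos^2\theta\cos^2(k-\alpha)}$. 1. Let $\Psi$ be a probe for which the state-dependent term of the QFI matrix vanishes, i.e. $\int_{-\pi}^{\pi}\frac{dk}{2\pi}((O_\mu|\mathcal A_k^{\mathbb 1}|\varrho_0))=0$ for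 $\mu=\theta,\alpha$. Then the model is compatible to leading order in the number of steps. That is, the symmetric logarithmic derivatives exist for all $t$, and as $t\to\infty$: - (i) $\mathcal U(t)/t^2\to0$; - (ii) $F(t)/t^2$ converges to a diagonal matrix, with diagonal entries $\int_{-\pi}^{\pi}\frac{dk}{2\pi}((O_\mu|\mathcal A_k^{\mathbb 1}|O_\mu))$; - (iii) both diagonal entries of this limit are simultaneously maximal among all probes: for every probe the limit of $F(t)/t^2$ exists, and its diagonal entries are not larger. 2. If $\Psi$ is a probe such that, for almost every $k$, the $x,y,z$ components of $\mathcal A_k^{\mathbb 1}|\varrho_0))$ vanish, then the state-dependent term vanishes and the model is compatible in the sense of 1. 3. For all $x_1,x_2\in\mathbb Z$ with $|x_1-x_2|$ odd, $(|x_1,0\rangle+|x_2,1\rangle)/\sqrt2$ is a probe, its state-dependent term vanishes, and the model is compatible in the sense of 1. -/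

import Mathlib

open Complex MeasureTheory Filter Topology
open scoped Matrix

noncomputable section

namespace QuantumWalk

/-! ### The walker: Hilbert space and evolution -/

/-- The Hilbert space `ℓ²(ℤ)` of the position degree of freedom. -/
abbrev Position : Type := lp (fun _ : ℤ => ℂ) 2

/-- The lattice-coin space `ℓ²(ℤ) ⊗ ℂ²`: `ψ j x` is the amplitude of `|x⟩ ⊗ |j⟩`. -/
abbrev Walker : Type := PiLp 2 (fun _ : Fin 2 => Position)

/-- Bounded operators on the lattice-coin space. -/
abbrev Op : Type := Walker →L[ℂ] Walker

/-- Translation by `a` sites on `ℓ²(ℤ)`, i.e. `|x⟩ ↦ |x + a⟩`. -/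
def translate (a : ℤ) (c : Position) : Position :=
  ⟨fun x => c (x - a), by
    have h := (memℓp_gen_iff (p := 2) (by norm_num)).1 (lp.memℓp c)
    exact (memℓp_gen_iff (p := 2) (by norm_num)).2
      ((Equiv.subRight a).summable_iff.2 h)⟩

/-- The coin operator `C_{θ,α,β}`. -/
def coin (θ α β : ℝ) : Matrix (Fin 2) (Fin 2) ℂ :=
  !![exp (I * α) * Real.cos θ, exp (I * β) * Real.sin θ;
     -exp (-(I * β)) * Real.sin θ, exp (-(I * α)) * Real.cos θ]

/-- `𝟙 ⊗ C`. -/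
def coinStep (C : Matrix (Fin 2) (Fin 2) ℂ) (ψ : Walker) : Walker :=
  WithLp.toLp 2 fun i => ∑ j, C i j • ψ j

/-- The conditional shift
`S = ∑ₓ |x+1⟩⟨x| ⊗ |0⟩⟨0| + |x-1⟩⟨x| ⊗ |1⟩⟨1|`. -/
def condShift (ψ : Walker) : Walker :=
  WithLp.toLp 2 ![translate 1 (ψ 0), translate (-1) (ψ 1)]

/-- One step `U = S (𝟙 ⊗ C)` of the walk. The two unknown parameters are collected in
`Θ = (θ, α)`; the third coin parameter `β` is known and fixed. -/
def step (β : ℝ) (Θ : Fin 2 → ℝ) (ψ : Walker) : Walker :=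
  condShift (coinStep (coin (Θ 0) (Θ 1) β) ψ)

/-- The state `|Ψ_Θ(t)⟩ = U_Θ^t |Ψ(0)⟩` after `t` steps. -/
def evolve (β : ℝ) (Θ : Fin 2 → ℝ) (t : ℕ) (Ψ : Walker) : Walker :=
  (step β Θ)^[t] Ψ

/-! ### Multi-parameter estimation: SLD, quantum Fisher information, Uhlmann curvature -/

/-- The density operator `|ψ⟩⟨ψ|`. -/
def density (ψ : Walker) : Op := InnerProductSpace.rankOne ℂ ψ ψ

/-- `L` is a symmetric logarithmic derivative, at the point `Θ` and with respect to the parameter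
`Θ μ`, of the model `ϱ_Θ = |Ψ_Θ(t)⟩⟨Ψ_Θ(t)|` with initial state `Ψ`: it is self-adjoint and
`∂_μ ϱ = (L ϱ + ϱ L) / 2`, the derivative being taken in operator norm. -/
def IsSLD (β : ℝ) (Θ : Fin 2 → ℝ) (t : ℕ) (Ψ : Walker) (μ : Fin 2) (L : Op) : Prop :=
  IsSelfAdjoint L ∧
    HasDerivAt (fun s : ℝ => density (evolve β (Function.update Θ μ s) t Ψ))
      ((1 / 2 : ℝ) • (L * density (evolve β Θ t Ψ) + density (evolve β Θ t Ψ) * L)) (Θ μ)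

/-- `½ Tr(ϱ {L, M})` for `ϱ = |ψ⟩⟨ψ|`; a real number when `L` and `M` are self-adjoint. -/
def qfi (ψ : Walker) (L M : Op) : ℝ :=
  ((1 / 2 : ℂ) * inner ℂ ψ ((L * M + M * L) ψ)).re

/-- `-(i/2) Tr(ϱ [L, M])` for `ϱ = |ψ⟩⟨ψ|`; a real number when `L` and `M` are self-adjoint. -/
def uhlmann (ψ : Walker) (L M : Op) : ℝ :=
  (-(I / 2) * inner ℂ ψ ((L * M - M * L) ψ)).re

/-- For every number of steps `t` both symmetric logarithmic derivatives exist. -/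
def HasSLDs (β : ℝ) (Θ : Fin 2 → ℝ) (Ψ : Walker) : Prop :=
  ∀ t μ, ∃ L, IsSLD β Θ t Ψ μ L

/-- The QFI matrix after `t` steps is `t² G` to leading order in the limit of many steps. -/
def HasLeadingQFIM (β : ℝ) (Θ : Fin 2 → ℝ) (Ψ : Walker) (G : Matrix (Fin 2) (Fin 2) ℝ) : Prop :=
  HasSLDs β Θ Ψ ∧
    ∀ L : ℕ → Fin 2 → Op, (∀ t μ, IsSLD β Θ t Ψ μ (L t μ)) → ∀ μ ν,
      Tendsto (fun t : ℕ => qfi (evolve β Θ t Ψ) (L t μ) (L t ν) / (t : ℝ) ^ 2) atTop (𝓝 (G μ ν))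

/-- The Uhlmann curvature matrix after `t` steps is `t² G` to leading order in the limit of many
steps. -/
def HasLeadingUhlmann (β : ℝ) (Θ : Fin 2 → ℝ) (Ψ : Walker) (G : Matrix (Fin 2) (Fin 2) ℝ) :
    Prop :=
  HasSLDs β Θ Ψ ∧
    ∀ L : ℕ → Fin 2 → Op, (∀ t μ, IsSLD β Θ t Ψ μ (L t μ)) → ∀ μ ν,
      Tendsto (fun t : ℕ => uhlmann (evolve β Θ t Ψ) (L t μ) (L t ν) / (t : ℝ) ^ 2) atTop
        (𝓝 (G μ ν))

/-! ### The `k`-space picture -/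

local instance instTwoPiPos : Fact (0 < 2 * Real.pi) := ⟨Real.two_pi_pos⟩

/-- The amplitude `|φ_k(0)⟩ = ⟨k|Ψ⟩ = ∑ₓ e^{-ikx} ∑ⱼ Ψ j x |j⟩` of `Ψ` in `k`-space. The Fourier
series converges in `L²`, so this is a function of `k` defined up to a null set. -/
def amplitude (Ψ : Walker) (k : ℝ) (j : Fin 2) : ℂ :=
  (fourierBasis (T := 2 * Real.pi)).repr.symm (Ψ j) ((-k : ℝ) : AddCircle (2 * Real.pi))

/-- `ϱ₀(k) = |φ_k(0)⟩⟨φ_k(0)|`, an operator on the coin space. -/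
def initialState (Ψ : Walker) (k : ℝ) : Matrix (Fin 2) (Fin 2) ℂ :=
  Matrix.vecMulVec (amplitude Ψ k) (star (amplitude Ψ k))

/-- Probe states: the coin operator `ϱ₀(k)` is a normalized state, `Tr ϱ₀(k) = 1`, for almost every
`k`, so that it is represented by a vector `(1, r)` with `r` its Bloch vector. -/
def IsProbe (Ψ : Walker) : Prop :=
  ∀ᵐ k : ℝ, (initialState Ψ k).trace = 1

/-- The evolution operator `u_k = (e^{-ik}|0⟩⟨0| + e^{ik}|1⟩⟨1|) C` in `k`-space. -/
def kStep (β k : ℝ) (Θ : Fin 2 → ℝ) : Matrix (Fin 2) (Fin 2) ℂ :=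
  !![exp (-(I * k)), 0; 0, exp (I * k)] * coin (Θ 0) (Θ 1) β

/-- `O_μ = u_k† ∂_μ u_k`. -/
def generator (β k : ℝ) (Θ : Fin 2 → ℝ) (μ : Fin 2) : Matrix (Fin 2) (Fin 2) ℂ :=
  (kStep β k Θ)ᴴ *
    Matrix.of fun i j => deriv (fun s : ℝ => kStep β k (Function.update Θ μ s) i j) (Θ μ)

/-- `σ₀ = 𝟙, σ_x, σ_y, σ_z`. -/
def pauli : Fin 4 → Matrix (Fin 2) (Fin 2) ℂ :=
  ![1, !![0, 1; 1, 0], !![0, -I; I, 0], !![1, 0; 0, -1]]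

/-- The four-component vector `|O))`, with entries `Tr(O σ_i)`. -/
def blochVec (O : Matrix (Fin 2) (Fin 2) ℂ) : Fin 4 → ℂ :=
  fun i => (O * pauli i).trace

/-- The matrix `A_k^𝟙`: the projector onto the vectors fixed by the adjoint action of `u_k`. -/
def projA (θ α β k : ℝ) : Matrix (Fin 4) (Fin 4) ℝ :=
  let N := Real.sin θ ^ 2 / (1 - Real.cos θ ^ 2 * Real.cos (k - α) ^ 2)
  let s := Real.sin (k - β)
  let c := Real.cos (k - β)
  let d := Real.cos θ / Real.sin θ * Real.sin (k - α)
  N • !![1 / N, 0, 0, 0;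
         0, s ^ 2, -(c * s), d * s;
         0, -(c * s), c ^ 2, -(d * c);
         0, d * s, -(d * c), d ^ 2]

/-- `A_k^𝟙 |ϱ₀))` for the initial state `Ψ`. -/
def projState (β : ℝ) (Θ : Fin 2 → ℝ) (Ψ : Walker) (k : ℝ) : Fin 4 → ℂ :=
  (projA (Θ 0) (Θ 1) β k).map (fun x : ℝ => (x : ℂ)) *ᵥ blochVec (initialState Ψ k)

/-- The initial-state-dependent term `∫_{-π}^{π} dk/2π ((O_μ| A_k^𝟙 |ϱ₀))` of the QFI matrix. -/
def stateTerm (β : ℝ) (Θ : Fin 2 → ℝ) (Ψ : Walker) (μ : Fin 2) : ℂ :=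
  (1 / (2 * Real.pi) : ℂ) * ∫ k in (-Real.pi)..Real.pi,
    star (blochVec (generator β k Θ μ)) ⬝ᵥ projState β Θ Ψ k

/-- The state-independent term `∫_{-π}^{π} dk/2π ((O_μ| A_k^𝟙 |O_ν))` of the QFI matrix. The
integrand is real, since the vectors `|O_μ))` are purely imaginary. -/
def freeTerm (β : ℝ) (Θ : Fin 2 → ℝ) (μ ν : Fin 2) : ℝ :=
  (1 / (2 * Real.pi)) * ∫ k in (-Real.pi)..Real.pi,
    (star (blochVec (generator β k Θ μ)) ⬝ᵥ
      ((projA (Θ 0) (Θ 1) β k).map (fun x : ℝ => (x : ℂ)) *ᵥ blochVec (generator β k Θ ν))).re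

/-! ### Compatible models and entangled probes -/

/-- The two-parameter model generated by the probe `Ψ` is compatible, to leading order `t²` in the
number of steps: the Uhlmann curvature vanishes, the QFI matrix is diagonal, and among all probe
states `Ψ` maximizes both of its diagonal entries. -/
def IsCompatible (β : ℝ) (Θ : Fin 2 → ℝ) (Ψ : Walker) : Prop :=
  HasLeadingUhlmann β Θ Ψ 0 ∧
    ∃ G, HasLeadingQFIM β Θ Ψ G ∧ G.IsDiag ∧
      ∀ Φ, IsProbe Φ → ∃ G', HasLeadingQFIM β Θ Φ G' ∧ ∀ μ, G' μ μ ≤ G μ μ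

/-- The state `(|x₁, 0⟩ + |x₂, 1⟩) / √2`. -/
def entangled (x₁ x₂ : ℤ) : Walker :=
  WithLp.toLp 2 ![lp.single 2 x₁ ((1 / Real.sqrt 2 : ℝ) : ℂ),
    lp.single 2 x₂ ((1 / Real.sqrt 2 : ℝ) : ℂ)]

end QuantumWalk

end

/-! The Fourier transform turns the walk into multiplication by the unitary matrices `kStep`, so
everything reduces to the growth in `t` of the derivative of a matrix power. Write u for `kStep`.
Then u = (cos ω) 1 + V, where V = `axis` is traceless and anti-Hermitian, V² = -sin² ω, and sin² ω =
`gap` is positive because sin θ ≠ 0.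

The generator O = u† ∂u splits as P + Q, with P = `commPart` a multiple of V and Q anticommuting
with V. The first commutes with u. The second is a coboundary u† W u - W, with W = `corrector`
(`kStepDeriv_eq`). Hence the Q-contributions telescope and u^{-t} ∂(u^t) = t P + u^{-t} W u^t - W
(`kPowDeriv_eq`), so that division by t leaves P up to a term of order 1/t.

For a pure state, the overlap of the two SLDs applied to ψ is four times ⟨∂_μψ|∂_νψ⟩ minus the
product of the projections on ψ (`inner_sld`). Its real part is the QFI entry and its imaginary part
the Uhlmann curvature. Dominated convergence gives the limit after division by t²
(`tendsto_inner_sld_div`): a state-independent term F_{μν}, because P_μ† P_ν is a real scalar matrix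
and a probe is normalized at almost every k, minus conj(s_μ) s_ν with s the state term.

Since |s_μ|² ≥ 0, the diagonal is largest when s = 0. The curvature then vanishes as well, and F is
diagonal because its off-diagonal integrand is odd about k = α. Part 2 uses that O is traceless;
part 3 that the integrand of s changes sign under k ↦ k + π. -/

noncomputable section

namespace QuantumWalk

attribute [local instance] instTwoPiPos

/-! ### The `k`-space picture -/

/-- The reflected covering map of the circle pulls back null sets to null sets. -/
theorem quasiMeasurePreserving_neg_coe :
    Measure.QuasiMeasurePreserving (fun k : ℝ => ((-k : ℝ) : AddCircle (2 * Real.pi)))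
      volume AddCircle.haarAddCircle := by
  have hcoe : Measure.QuasiMeasurePreserving (fun k : ℝ => (k : AddCircle (2 * Real.pi)))
      volume AddCircle.haarAddCircle := by
    refine ⟨AddCircle.measurable_mk', Measure.AbsolutelyContinuous.mk fun s hs h0 => ?_⟩
    rw [Measure.map_apply AddCircle.measurable_mk' hs]
    have h1 : (volume : Measure (AddCircle (2 * Real.pi))) s = 0 := by
      rw [AddCircle.volume_eq_smul_haarAddCircle, Measure.smul_apply, h0, smul_zero]
    -- The covering map preserves measure on each single period, and countably many periods exhaust
    -- the line.
    have h2 : ∀ n : ℤ, volume.restrict (Set.Ioc (n • (2 * Real.pi)) ((n + 1) • (2 * Real.pi)))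
        ((fun k : ℝ => (k : AddCircle (2 * Real.pi))) ⁻¹' s) = 0 := fun n => by
      have := (AddCircle.measurePreserving_mk (2 * Real.pi) (n • (2 * Real.pi))).measure_preimage
        hs.nullMeasurableSet
      rw [add_zsmul, one_zsmul, ← h1]
      exact this
    rw [← Measure.restrict_univ (μ := (volume : Measure ℝ)), ← iUnion_Ioc_zsmul Real.two_pi_pos]
    exact (Measure.restrict_iUnion_le _).trans_eq
      ((Measure.sum_apply _ (AddCircle.measurable_mk' hs)).trans (ENNReal.tsum_eq_zero.2 h2)) |>.antisymm bot_le
  exact hcoe.comp (Measure.measurePreserving_neg (volume : Measure ℝ)).quasiMeasurePreserving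

theorem amplitude_add (ψ χ : Walker) (j : Fin 2) :
    ∀ᵐ k : ℝ, amplitude (ψ + χ) k j = amplitude ψ k j + amplitude χ k j := by
  have h := Lp.coeFn_add ((fourierBasis (T := 2 * Real.pi)).repr.symm (ψ j))
    ((fourierBasis (T := 2 * Real.pi)).repr.symm (χ j))
  filter_upwards [quasiMeasurePreserving_neg_coe.ae h] with k hk
  simpa [amplitude] using hk

theorem amplitude_smul (c : ℂ) (ψ : Walker) (j : Fin 2) :
    ∀ᵐ k : ℝ, amplitude (c • ψ) k j = c * amplitude ψ k j := by
  have h := Lp.coeFn_smul c ((fourierBasis (T := 2 * Real.pi)).repr.symm (ψ j))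
  filter_upwards [quasiMeasurePreserving_neg_coe.ae h] with k hk
  simpa [amplitude] using hk

theorem aestronglyMeasurable_amplitude (ψ : Walker) (j : Fin 2) :
    AEStronglyMeasurable (fun k : ℝ => amplitude ψ k j) :=
  (Lp.aestronglyMeasurable _).comp_quasiMeasurePreserving quasiMeasurePreserving_neg_coe

theorem integral_neg_coe_eq (f : AddCircle (2 * Real.pi) → ℂ) :
    ∫ x, f x ∂AddCircle.haarAddCircle =
      (1 / (2 * Real.pi) : ℂ) *
        ∫ k in (-Real.pi)..Real.pi, f ((-k : ℝ) : AddCircle (2 * Real.pi)) := by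
  rw [AddCircle.integral_haarAddCircle,
    intervalIntegral.integral_comp_neg (fun k : ℝ => f (k : AddCircle (2 * Real.pi))),
    ← AddCircle.intervalIntegral_preimage (2 * Real.pi) (-Real.pi) f,
    show -Real.pi + 2 * Real.pi = - -Real.pi by ring, Complex.real_smul]
  push_cast
  simp

theorem inner_position_eq_integral (c d : Position) :
    inner ℂ c d = ∫ x, star ((fourierBasis (T := 2 * Real.pi)).repr.symm c x) *
      (fourierBasis (T := 2 * Real.pi)).repr.symm d x ∂AddCircle.haarAddCircle := by
  rw [← (fourierBasis (T := 2 * Real.pi)).repr.symm.inner_map_map, MeasureTheory.L2.inner_def]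
  simp [RCLike.inner_apply, mul_comm]

theorem integrable_star_mul (f g : Lp ℂ 2 (AddCircle.haarAddCircle (T := 2 * Real.pi))) :
    Integrable (fun x => star (f x) * g x) AddCircle.haarAddCircle := by
  have := MeasureTheory.L2.integrable_inner (𝕜 := ℂ) f g
  simpa [RCLike.inner_apply, mul_comm] using this

/-- Parseval: inner products of walker states in `k`-space. -/
theorem inner_eq_integral (ψ χ : Walker) :
    inner ℂ ψ χ = (1 / (2 * Real.pi) : ℂ) * ∫ k in (-Real.pi)..Real.pi,
      star (amplitude ψ k) ⬝ᵥ amplitude χ k := by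
  rw [PiLp.inner_apply]
  simp_rw [inner_position_eq_integral]
  rw [← integral_finsetSum _ fun i _ => integrable_star_mul _ _, integral_neg_coe_eq]
  rfl

/-- Translations act in `k`-space as multiplication by characters. -/
theorem repr_symm_translate (a : ℤ) (c : Position) :
    (fourierBasis (T := 2 * Real.pi)).repr.symm (translate a c) =ᵐ[AddCircle.haarAddCircle]
      fun x => fourier a x * (fourierBasis (T := 2 * Real.pi)).repr.symm c x := by
  set f := (fourierBasis (T := 2 * Real.pi)).repr.symm c with hf
  have hmem : MemLp (fun x => fourier a x * f x) 2
      (AddCircle.haarAddCircle (T := 2 * Real.pi)) := by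
    refine (Lp.memLp f).of_le
      ((fourier a).continuous.aestronglyMeasurable.mul (Lp.aestronglyMeasurable f))
      (ae_of_all _ fun x => ?_)
    rw [norm_mul, fourier_apply, Circle.norm_coe, one_mul]
  -- The two functions are compared through their Fourier coefficients: multiplication by the
  -- character a shifts the index n to n - a.
  have key : (fourierBasis (T := 2 * Real.pi)).repr.symm (translate a c) = hmem.toLp _ := by
    rw [LinearIsometryEquiv.symm_apply_eq]
    ext n
    rw [fourierBasis_repr, fourierCoeff_congr_ae hmem.coeFn_toLp]
    have hc : c = (fourierBasis (T := 2 * Real.pi)).repr f := by simp [hf]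
    change c (n - a) = _
    rw [hc, fourierBasis_repr, fourierCoeff, fourierCoeff]
    congr 1 with x
    rw [smul_eq_mul, smul_eq_mul, ← mul_assoc, ← fourier_add]
    congr 3
    ring
  rw [key]
  exact hmem.coeFn_toLp

theorem fourier_neg_coe (a : ℤ) (k : ℝ) :
    fourier a ((-k : ℝ) : AddCircle (2 * Real.pi)) = exp (-(I * (a * k))) := by
  rw [fourier_coe_apply]
  congr 1
  have : (Real.pi : ℂ) ≠ 0 := by exact_mod_cast Real.pi_ne_zero
  push_cast
  field_simp

/-- One coin toss and conditional shift in `k`-space. -/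
theorem amplitude_condShift_coinStep (C : Matrix (Fin 2) (Fin 2) ℂ) (ψ : Walker) :
    ∀ᵐ k : ℝ, amplitude (condShift (coinStep C ψ)) k =
      (!![exp (-(I * k)), 0; 0, exp (I * k)] * C) *ᵥ amplitude ψ k := by
  have hq := quasiMeasurePreserving_neg_coe
  have hC : ∀ i, ∀ᵐ k : ℝ, amplitude (coinStep C ψ) k i = (C *ᵥ amplitude ψ k) i := fun i => by
    have h0 := Lp.coeFn_add (C i 0 • (fourierBasis (T := 2 * Real.pi)).repr.symm (ψ 0))
      (C i 1 • (fourierBasis (T := 2 * Real.pi)).repr.symm (ψ 1))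
    have h1 := fun j => Lp.coeFn_smul (C i j) ((fourierBasis (T := 2 * Real.pi)).repr.symm (ψ j))
    filter_upwards [hq.ae h0, hq.ae (h1 0), hq.ae (h1 1)] with k h0 h1 h2
    rw [Pi.add_apply, h1, h2] at h0
    simpa [amplitude, coinStep, Matrix.mulVec, dotProduct, Fin.sum_univ_two] using h0
  have h0 := repr_symm_translate 1 ((coinStep C ψ) 0)
  have h1 := repr_symm_translate (-1) ((coinStep C ψ) 1)
  filter_upwards [hC 0, hC 1, hq.ae h0, hq.ae h1] with k hk0 hk1 h0 h1
  rw [fourier_neg_coe] at h0 h1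
  rw [← Matrix.mulVec_mulVec]
  ext i
  fin_cases i
  · refine h0.trans ?_
    have : (fourierBasis (T := 2 * Real.pi)).repr.symm ((coinStep C ψ) 0)
      ((-k : ℝ) : AddCircle (2 * Real.pi)) = (C *ᵥ amplitude ψ k) 0 := hk0
    rw [this]
    simp [Matrix.mulVec, dotProduct, Fin.sum_univ_two]
  · refine h1.trans ?_
    have : (fourierBasis (T := 2 * Real.pi)).repr.symm ((coinStep C ψ) 1)
      ((-k : ℝ) : AddCircle (2 * Real.pi)) = (C *ᵥ amplitude ψ k) 1 := hk1
    rw [this]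
    simp [Matrix.mulVec, dotProduct, Fin.sum_univ_two]

theorem amplitude_entangled (x₁ x₂ : ℤ) :
    ∀ᵐ k : ℝ, amplitude (entangled x₁ x₂) k =
      ((1 / Real.sqrt 2 : ℝ) : ℂ) • ![exp (-(I * (x₁ * k))), exp (-(I * (x₂ * k)))] := by
  have hsingle : ∀ (x : ℤ) (c : ℂ), ∀ᵐ k : ℝ,
      (fourierBasis (T := 2 * Real.pi)).repr.symm (lp.single 2 x c)
        ((-k : ℝ) : AddCircle (2 * Real.pi)) = c * exp (-(I * (x * k))) := fun x c => by
    have h : (fourierBasis (T := 2 * Real.pi)).repr.symm (lp.single 2 x c) =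
        c • fourierLp 2 x := by
      have : (lp.single 2 x c : Position) = c • lp.single 2 x 1 := by
        rw [← lp.single_smul]; simp
      rw [this, map_smul, HilbertBasis.repr_symm_single, coe_fourierBasis]
    filter_upwards [quasiMeasurePreserving_neg_coe.ae (Lp.coeFn_smul c (fourierLp 2 x)),
      quasiMeasurePreserving_neg_coe.ae (coeFn_fourierLp 2 x)] with k h1 h2
    rw [h, h1, Pi.smul_apply, h2, fourier_neg_coe, smul_eq_mul]
  filter_upwards [hsingle x₁ ((1 / Real.sqrt 2 : ℝ) : ℂ),
    hsingle x₂ ((1 / Real.sqrt 2 : ℝ) : ℂ)] with k h1 h2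
  ext i
  fin_cases i
  · exact h1
  · exact h2

/-! ### One step of the walk in `k`-space -/

/-- The entrywise derivative of the coin with respect to the parameter `Θ μ`. -/
def coinDeriv (β : ℝ) (Θ : Fin 2 → ℝ) : Fin 2 → Matrix (Fin 2) (Fin 2) ℂ :=
  ![!![-(exp (I * Θ 1) * Real.sin (Θ 0)), exp (I * β) * Real.cos (Θ 0);
       -(exp (-(I * β)) * Real.cos (Θ 0)), -(exp (-(I * Θ 1)) * Real.sin (Θ 0))],
    !![I * exp (I * Θ 1) * Real.cos (Θ 0), 0;
       0, -(I * exp (-(I * Θ 1)) * Real.cos (Θ 0))]]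

theorem hasDerivAt_coin (β : ℝ) (Θ : Fin 2 → ℝ) (μ i j : Fin 2) :
    HasDerivAt (fun s : ℝ => coin (Function.update Θ μ s 0) (Function.update Θ μ s 1) β i j)
      (coinDeriv β Θ μ i j) (Θ μ) := by
  have hexp : ∀ (c : ℂ) (x : ℝ), HasDerivAt (fun s : ℝ => exp (c * s)) (c * exp (c * x)) x :=
    fun c x => by
      exact ((hasDerivAt_id (x : ℂ)).const_mul c).cexp.comp_ofReal.congr_deriv
        (by rw [mul_one]; exact mul_comm _ _)
  have hcos := (Real.hasDerivAt_cos (Θ 0)).ofReal_comp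
  have hsin := (Real.hasDerivAt_sin (Θ 0)).ofReal_comp
  fin_cases μ
  · fin_cases i <;> fin_cases j <;> simp only [coin, coinDeriv]
    · exact (hcos.const_mul (exp (I * Θ 1))).congr_deriv (by simp)
    · simpa using hsin.const_mul (exp (I * β))
    · simpa using hsin.const_mul (-exp (-(I * β)))
    · simpa using hcos.const_mul (exp (-(I * Θ 1)))
  · fin_cases i <;> fin_cases j <;> simp only [coin, coinDeriv]
    · simpa using (hexp I (Θ 1)).mul_const (Real.cos (Θ 0) : ℂ)
    · simpa using hasDerivAt_const (Θ 1) (exp (I * β) * Real.sin (Θ 0))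
    · simpa using hasDerivAt_const (Θ 1) (-exp (-(I * β)) * Real.sin (Θ 0))
    · have h := (hexp (-I) (Θ 1)).mul_const (Real.cos (Θ 0) : ℂ)
      simp only [neg_mul] at h
      exact h

/-- The derivative of `kStep` with respect to the parameter `Θ μ`. -/
def kStepDeriv (β k : ℝ) (Θ : Fin 2 → ℝ) (μ : Fin 2) : Matrix (Fin 2) (Fin 2) ℂ :=
  !![exp (-(I * k)), 0; 0, exp (I * k)] * coinDeriv β Θ μ

theorem generator_eq (β k : ℝ) (Θ : Fin 2 → ℝ) (μ : Fin 2) :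
    generator β k Θ μ = (kStep β k Θ)ᴴ * kStepDeriv β k Θ μ := by
  rw [generator]
  congr 1
  ext i j
  rw [Matrix.of_apply]
  refine HasDerivAt.deriv ?_
  simp only [kStep, kStepDeriv, Matrix.mul_apply, Fin.sum_univ_two]
  exact ((hasDerivAt_coin β Θ μ 0 j).const_mul _).add ((hasDerivAt_coin β Θ μ 1 j).const_mul _)

/-- The traceless part of `kStep`. -/
def axis (β k : ℝ) (Θ : Fin 2 → ℝ) : Matrix (Fin 2) (Fin 2) ℂ :=
  !![-(I * Real.cos (Θ 0) * Real.sin (k - Θ 1)), exp (-(I * k)) * (exp (I * β) * Real.sin (Θ 0));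
     -(exp (I * k) * (exp (-(I * β)) * Real.sin (Θ 0))), I * Real.cos (Θ 0) * Real.sin (k - Θ 1)]

/-- The squared length `sin² ω` of the traceless part of `kStep`, whose eigenvalues are
`e^{± i ω}`. -/
def gap (k : ℝ) (Θ : Fin 2 → ℝ) : ℝ := 1 - Real.cos (Θ 0) ^ 2 * Real.cos (k - Θ 1) ^ 2

/-- The coefficient of `axis` in the part of the generator which commutes with `kStep`. -/
def weight (k : ℝ) (Θ : Fin 2 → ℝ) (μ : Fin 2) : ℝ :=
  ![Real.sin (Θ 0) * Real.cos (k - Θ 1), -(Real.cos (Θ 0) * Real.sin (k - Θ 1))] μ / gap k Θ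

theorem gap_pos (k : ℝ) {Θ : Fin 2 → ℝ} (hθ : Real.sin (Θ 0) ≠ 0) : 0 < gap k Θ := by
  have h1 := Real.sin_sq_add_cos_sq (Θ 0)
  have h2 := Real.sin_sq_add_cos_sq (k - Θ 1)
  have h3 : 0 < Real.sin (Θ 0) ^ 2 := by positivity
  rw [gap]
  nlinarith [mul_nonneg (sq_nonneg (Real.cos (Θ 0))) (sq_nonneg (Real.sin (k - Θ 1)))]

/-! ### Exponential and trigonometric identities, and the SU(2) structure of one step. -/

theorem exp_I_mul_ofReal (x : ℝ) : exp (I * x) = Real.cos x + I * Real.sin x := by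
  rw [mul_comm, exp_mul_I, ofReal_cos, ofReal_sin, mul_comm I]

theorem exp_neg_I_mul_ofReal (x : ℝ) : exp (-(I * x)) = Real.cos x - I * Real.sin x := by
  have := exp_I_mul_ofReal (-x)
  rw [Real.cos_neg, Real.sin_neg] at this
  push_cast at this ⊢
  rw [← mul_neg, this]
  ring

theorem ofReal_cos_sub (x y : ℝ) :
    (Real.cos (x - y) : ℂ) = Real.cos x * Real.cos y + Real.sin x * Real.sin y := by
  rw [Real.cos_sub]; push_cast; rfl

theorem ofReal_sin_sub (x y : ℝ) :
    (Real.sin (x - y) : ℂ) = Real.sin x * Real.cos y - Real.cos x * Real.sin y := by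
  rw [Real.sin_sub]; push_cast; rfl

theorem ofReal_sin_sq_add_cos_sq (x : ℝ) :
    (Real.sin x : ℂ) ^ 2 + (Real.cos x : ℂ) ^ 2 = 1 := by
  exact_mod_cast Real.sin_sq_add_cos_sq x

theorem exp_I_mul_mul_exp_neg (x : ℝ) : exp (I * x) * exp (-(I * x)) = 1 := by
  rw [← exp_add]; simp

theorem star_exp_I_mul (x : ℝ) : star (exp (I * x)) = exp (-(I * x)) := by
  rw [← starRingEnd_apply, ← exp_conj]; simp

theorem star_exp_neg_I_mul (x : ℝ) : star (exp (-(I * x))) = exp (I * x) := by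
  rw [← star_exp_I_mul, star_star]

theorem star_ofReal (x : ℝ) : star (x : ℂ) = x := conj_ofReal x

/-- The splitting (cos ω) 1 + V: whatever commutes with V commutes with u, and whatever anticommutes
with V has an explicit commutator with u. -/
theorem kStep_eq (β k : ℝ) (Θ : Fin 2 → ℝ) :
    kStep β k Θ = ((Real.cos (Θ 0) * Real.cos (k - Θ 1) : ℝ) : ℂ) • 1 + axis β k Θ := by
  ext i j
  fin_cases i <;> fin_cases j <;>
    simp only [kStep, coin, axis, Matrix.mul_apply, Fin.sum_univ_two, Fin.zero_eta, Fin.mk_one,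
      Matrix.add_apply, Matrix.smul_apply, Matrix.one_apply, Matrix.of_apply, Matrix.cons_val',
      Matrix.cons_val_zero, Matrix.cons_val_one, Matrix.cons_val_fin_one, ofReal_mul,
      ofReal_cos_sub, ofReal_sin_sub, smul_eq_mul]
  · simp only [exp_I_mul_ofReal, exp_neg_I_mul_ofReal, if_true]
    linear_combination (-Real.sin k * Real.sin (Θ 1) * Real.cos (Θ 0) : ℂ) * I_sq
  · simp
  · simp
  · simp only [exp_I_mul_ofReal, exp_neg_I_mul_ofReal, if_true]
    linear_combination (-Real.sin k * Real.sin (Θ 1) * Real.cos (Θ 0) : ℂ) * I_sq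

theorem axis_conjTranspose (β k : ℝ) (Θ : Fin 2 → ℝ) : (axis β k Θ)ᴴ = -axis β k Θ := by
  ext i j
  fin_cases i <;> fin_cases j <;>
    simp [axis, Matrix.conjTranspose_apply, -RCLike.star_def, star_exp_I_mul, star_exp_neg_I_mul,
      star_ofReal, -ofReal_cos, -ofReal_sin, star_neg, star_mul']

/-- Cayley–Hamilton for a traceless 2×2 matrix: the scalar is minus the determinant, here cos² θ
sin² (k - α) + sin² θ, which equals `gap`. -/
theorem axis_mul_axis (β k : ℝ) (Θ : Fin 2 → ℝ) :
    axis β k Θ * axis β k Θ = -((gap k Θ : ℝ) : ℂ) • 1 := by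
  have hk := exp_I_mul_mul_exp_neg k
  have hβ := exp_I_mul_mul_exp_neg β
  have h0 := ofReal_sin_sq_add_cos_sq (Θ 0)
  have h1 := ofReal_sin_sq_add_cos_sq (k - Θ 1)
  have hg : ((gap k Θ : ℝ) : ℂ) = 1 - (Real.cos (Θ 0) : ℂ) ^ 2 * (Real.cos (k - Θ 1) : ℂ) ^ 2 := by
    rw [gap]; push_cast; rfl
  rw [hg]
  generalize hs : (Real.sin (k - Θ 1) : ℂ) = s at *
  generalize hc : (Real.cos (k - Θ 1) : ℂ) = c at *
  generalize hs0 : (Real.sin (Θ 0) : ℂ) = s0 at *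
  generalize hc0 : (Real.cos (Θ 0) : ℂ) = c0 at *
  ext i j
  fin_cases i <;> fin_cases j <;>
    simp only [axis, Matrix.mul_apply, Fin.sum_univ_two, Fin.zero_eta, Fin.mk_one,
      Matrix.smul_apply, Matrix.one_apply, Matrix.of_apply, Matrix.cons_val',
      Matrix.cons_val_zero, Matrix.cons_val_one, Matrix.cons_val_fin_one, smul_eq_mul, if_true,
      one_ne_zero, zero_ne_one, if_false, hs, hs0, hc0] <;>
    generalize exp (I * k) = a at * <;> generalize exp (-(I * k)) = a' at * <;>
    generalize exp (I * β) = b at * <;> generalize exp (-(I * β)) = b' at *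
  · linear_combination c0 ^ 2 * s ^ 2 * I_sq - s0 ^ 2 * b * b' * hk - s0 ^ 2 * hβ - c0 ^ 2 * h1 - h0
  · ring
  · ring
  · linear_combination c0 ^ 2 * s ^ 2 * I_sq - s0 ^ 2 * b * b' * hk - s0 ^ 2 * hβ - c0 ^ 2 * h1 - h0

theorem kStep_conjTranspose (β k : ℝ) (Θ : Fin 2 → ℝ) :
    (kStep β k Θ)ᴴ = ((Real.cos (Θ 0) * Real.cos (k - Θ 1) : ℝ) : ℂ) • 1 - axis β k Θ := by
  rw [kStep_eq, Matrix.conjTranspose_add, axis_conjTranspose, Matrix.conjTranspose_smul,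
    star_ofReal, Matrix.conjTranspose_one, ← sub_eq_add_neg]

theorem kStep_conjTranspose_mul (β k : ℝ) (Θ : Fin 2 → ℝ) :
    (kStep β k Θ)ᴴ * kStep β k Θ = 1 := by
  have hg : ((gap k Θ : ℝ) : ℂ) = 1 - ((Real.cos (Θ 0) * Real.cos (k - Θ 1) : ℝ) : ℂ) *
      ((Real.cos (Θ 0) * Real.cos (k - Θ 1) : ℝ) : ℂ) := by
    rw [gap]; push_cast; ring
  rw [kStep_conjTranspose, kStep_eq, sub_mul, mul_add, mul_add, axis_mul_axis, hg]
  simp only [smul_mul_assoc, mul_smul_comm, one_mul, mul_one, smul_smul]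
  module

theorem kStep_mem_unitary (β k : ℝ) (Θ : Fin 2 → ℝ) :
    kStep β k Θ ∈ Matrix.unitaryGroup (Fin 2) ℂ :=
  Matrix.mem_unitaryGroup_iff'.2 (kStep_conjTranspose_mul β k Θ)

theorem kStep_mul_generator (β k : ℝ) (Θ : Fin 2 → ℝ) (μ : Fin 2) :
    kStep β k Θ * generator β k Θ μ = kStepDeriv β k Θ μ := by
  rw [generator_eq, ← mul_assoc, mul_eq_one_comm.1 (kStep_conjTranspose_mul β k Θ), one_mul]

/-- The k-dependent diagonal factor of the step is unitary and free of the parameters, so it cancels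
in u† ∂u and the generator does not depend on k. -/
theorem generator_eq_explicit (β k : ℝ) (Θ : Fin 2 → ℝ) (μ : Fin 2) :
    generator β k Θ μ =
      ![!![0, exp (I * β) * exp (-(I * Θ 1)); -(exp (-(I * β)) * exp (I * Θ 1)), 0],
        !![I * Real.cos (Θ 0) ^ 2,
            I * Real.sin (Θ 0) * Real.cos (Θ 0) * (exp (I * β) * exp (-(I * Θ 1)));
          I * Real.sin (Θ 0) * Real.cos (Θ 0) * (exp (-(I * β)) * exp (I * Θ 1)),
            -(I * Real.cos (Θ 0) ^ 2)]] μ := by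
  have hk : (!![exp (-(I * k)), 0; 0, exp (I * k)] : Matrix (Fin 2) (Fin 2) ℂ)ᴴ *
      !![exp (-(I * k)), 0; 0, exp (I * k)] = 1 := by
    ext i j
    fin_cases i <;> fin_cases j <;>
      simp [Matrix.mul_apply, ← exp_conj, ← exp_add]
  rw [generator_eq, kStep, kStepDeriv, Matrix.conjTranspose_mul, mul_assoc, ← mul_assoc _ _
    (coinDeriv β Θ μ), hk, one_mul]
  have hα := exp_I_mul_mul_exp_neg (Θ 1)
  have hβ := exp_I_mul_mul_exp_neg β
  have h0 := ofReal_sin_sq_add_cos_sq (Θ 0)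
  ext i j
  fin_cases μ <;> fin_cases i <;> fin_cases j <;>
    simp only [coin, coinDeriv, Matrix.mul_apply, Fin.sum_univ_two, Fin.zero_eta, Fin.mk_one,
      Matrix.conjTranspose_apply, Matrix.of_apply, Matrix.cons_val', star_mul', star_neg,
      Matrix.cons_val_zero, Matrix.cons_val_one, Matrix.cons_val_fin_one, star_exp_I_mul,
      star_exp_neg_I_mul, star_ofReal] <;>
    generalize exp (I * Θ 1) = a at * <;> generalize exp (-(I * Θ 1)) = a' at * <;>
    generalize exp (I * β) = b at * <;> generalize exp (-(I * β)) = b' at * <;>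
    generalize (Real.sin (Θ 0) : ℂ) = s at * <;> generalize (Real.cos (Θ 0) : ℂ) = c at *
  · linear_combination - s * c * hα + s * c * hβ
  · linear_combination a' * b * h0
  · linear_combination - a * b' * h0
  · linear_combination - s * c * hα + s * c * hβ
  · linear_combination I * c ^ 2 * hα
  · ring
  · ring
  · linear_combination - I * c ^ 2 * hα

/-- Traceless 2×2 matrices have scalar anticommutators, and the scalar measures the component along
V. The matrix `weight` • V has the same anticommutator with V, so its difference from the generator
anticommutes with V. -/
theorem generator_anticomm_axis (β k : ℝ) {Θ : Fin 2 → ℝ} (hθ : Real.sin (Θ 0) ≠ 0) (μ : Fin 2) :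
    generator β k Θ μ * axis β k Θ + axis β k Θ * generator β k Θ μ =
      ((-(2 * weight k Θ μ * gap k Θ) : ℝ) : ℂ) • 1 := by
  have hw : weight k Θ μ * gap k Θ =
      ![Real.sin (Θ 0) * Real.cos (k - Θ 1), -(Real.cos (Θ 0) * Real.sin (k - Θ 1))] μ := by
    rw [weight, div_mul_cancel₀ _ (gap_pos k hθ).ne']
  rw [mul_assoc, hw, generator_eq_explicit]
  have hk := exp_I_mul_mul_exp_neg k
  have hα := exp_I_mul_mul_exp_neg (Θ 1)
  have hβ := exp_I_mul_mul_exp_neg β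
  have h0 := ofReal_sin_sq_add_cos_sq (Θ 0)
  have hc : 2 * (Real.cos (k - Θ 1) : ℂ) =
      exp (I * k) * exp (-(I * Θ 1)) + exp (-(I * k)) * exp (I * Θ 1) := by
    rw [ofReal_cos_sub]; simp only [exp_I_mul_ofReal, exp_neg_I_mul_ofReal]
    linear_combination (2 * Real.sin k * Real.sin (Θ 1) : ℂ) * I_sq
  have hs : 2 * (I * Real.sin (k - Θ 1) : ℂ) =
      exp (I * k) * exp (-(I * Θ 1)) - exp (-(I * k)) * exp (I * Θ 1) := by
    rw [ofReal_sin_sub]; simp only [exp_I_mul_ofReal, exp_neg_I_mul_ofReal]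
    ring
  have hI : I * I = -1 := I_mul_I
  ext i j
  fin_cases μ <;> fin_cases i <;> fin_cases j <;>
    simp only [axis, Matrix.mul_apply, Matrix.add_apply, Fin.sum_univ_two, Fin.zero_eta,
      Fin.mk_one, Matrix.of_apply, Matrix.cons_val', Matrix.smul_apply, Matrix.one_apply,
      Matrix.cons_val_zero, Matrix.cons_val_one, Matrix.cons_val_fin_one, ofReal_mul, ofReal_neg,
      smul_eq_mul, if_true, ofReal_ofNat,
      one_ne_zero, zero_ne_one, if_false] <;>
    generalize exp (I * Θ 1) = a at * <;> generalize exp (-(I * Θ 1)) = a' at * <;>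
    generalize exp (I * β) = b at * <;> generalize exp (-(I * β)) = b' at * <;>
    generalize exp (I * k) = e at * <;> generalize exp (-(I * k)) = e' at * <;>
    generalize (Real.sin (Θ 0) : ℂ) = s at * <;> generalize (Real.cos (Θ 0) : ℂ) = c at * <;>
    generalize (Real.sin (k - Θ 1) : ℂ) = sq at * <;> generalize (Real.cos (k - Θ 1) : ℂ) = cq at *
  · linear_combination s * hc - s * (a' * e + e' * a) * hβ
  · ring
  · ring
  · linear_combination s * hc - s * (a' * e + e' * a) * hβ
  · linear_combination -2 * (c ^ 3 * sq + s ^ 2 * c * sq) * I_sq +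
      I * s ^ 2 * c * (e' * a - e * a') * hβ + I * s ^ 2 * c * hs + 2 * c * sq * h0
  · ring
  · ring
  · linear_combination -2 * (c ^ 3 * sq + s ^ 2 * c * sq) * I_sq +
      I * s ^ 2 * c * (e' * a - e * a') * hβ + I * s ^ 2 * c * hs + 2 * c * sq * h0

/-! ### The quadratic form of `projA` as a projection along the axis. -/

/-- The form `((x| A |y))`, with the nontrivial block of `projA` written as a rank-one matrix. -/
theorem star_dotProduct_projA (β k : ℝ) {Θ : Fin 2 → ℝ} (hθ : Real.sin (Θ 0) ≠ 0)
    (x y : Fin 4 → ℂ) :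
    star x ⬝ᵥ ((projA (Θ 0) (Θ 1) β k).map (fun r : ℝ => (r : ℂ)) *ᵥ y) =
      star (x 0) * y 0 + (Real.sin (Θ 0) ^ 2 / gap k Θ : ℝ) *
        star (Real.sin (k - β) * x 1 - Real.cos (k - β) * x 2 +
          (Real.cos (Θ 0) / Real.sin (Θ 0) * Real.sin (k - Θ 1) : ℝ) * x 3) *
        (Real.sin (k - β) * y 1 - Real.cos (k - β) * y 2 +
          (Real.cos (Θ 0) / Real.sin (Θ 0) * Real.sin (k - Θ 1) : ℝ) * y 3) := by
  have hN : (Real.sin (Θ 0) ^ 2 / gap k Θ) * (1 / (Real.sin (Θ 0) ^ 2 / gap k Θ)) = 1 :=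
    mul_one_div_cancel (div_ne_zero (pow_ne_zero 2 hθ) (gap_pos k hθ).ne')
  have hN' := congrArg (fun r : ℝ => (r : ℂ)) hN
  change _ = ((1 : ℝ) : ℂ) at hN'
  have hA : projA (Θ 0) (Θ 1) β k =
      let N := Real.sin (Θ 0) ^ 2 / gap k Θ
      let s := Real.sin (k - β)
      let c := Real.cos (k - β)
      let d := Real.cos (Θ 0) / Real.sin (Θ 0) * Real.sin (k - Θ 1)
      N • !![1 / N, 0, 0, 0;
             0, s ^ 2, -(c * s), d * s;
             0, -(c * s), c ^ 2, -(d * c);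
             0, d * s, -(d * c), d ^ 2] := rfl
  rw [hA]
  generalize Real.sin (Θ 0) ^ 2 / gap k Θ = N at *
  generalize Real.cos (Θ 0) / Real.sin (Θ 0) * Real.sin (k - Θ 1) = d
  simp only [dotProduct, Matrix.mulVec, Fin.sum_univ_four, Matrix.map_apply, Matrix.smul_apply,
    Matrix.of_apply, Matrix.cons_val', Matrix.cons_val_zero, Matrix.cons_val_one,
    Matrix.cons_val_fin_one, Matrix.cons_val,
    smul_eq_mul, Pi.star_apply, star_add, star_sub, star_mul', star_ofReal, hN']
  push_cast
  ring

/-- The vector (s, -c, d) spanning the nontrivial block of `projA` is the Pauli coordinate vector of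
i V / sin θ. -/
theorem blochVec_dot_axis (β k : ℝ) {Θ : Fin 2 → ℝ} (hθ : Real.sin (Θ 0) ≠ 0)
    (O : Matrix (Fin 2) (Fin 2) ℂ) :
    Real.sin (k - β) * blochVec O 1 - Real.cos (k - β) * blochVec O 2 +
      (Real.cos (Θ 0) / Real.sin (Θ 0) * Real.sin (k - Θ 1) : ℝ) * blochVec O 3 =
      I / Real.sin (Θ 0) * (O * axis β k Θ).trace := by
  have hs : (Real.sin (Θ 0) : ℂ) ≠ 0 := by exact_mod_cast hθ
  simp only [blochVec, pauli, Matrix.trace_fin_two, Matrix.mul_apply, Fin.sum_univ_two, axis,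
    Matrix.of_apply, Matrix.cons_val', Matrix.cons_val_zero, Matrix.cons_val_one, Matrix.cons_val,
    Matrix.cons_val_fin_one]
  push_cast [-ofReal_sin, -ofReal_cos]
  have h1 : exp (-(I * k)) * exp (I * β) = Real.cos (k - β) - I * Real.sin (k - β) := by
    rw [← exp_neg_I_mul_ofReal, ← exp_add]; congr 1; push_cast; ring
  have h2 : exp (I * k) * exp (-(I * β)) = Real.cos (k - β) + I * Real.sin (k - β) := by
    rw [← exp_I_mul_ofReal, ← exp_add]; congr 1; push_cast; ring
  have hst := mul_inv_cancel₀ hs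
  rw [div_eq_mul_inv, div_eq_mul_inv]
  generalize exp (I * k) = e at *
  generalize exp (-(I * k)) = e' at *
  generalize exp (I * β) = b at *
  generalize exp (-(I * β)) = b' at *
  generalize (Real.sin (Θ 0) : ℂ) = s at *
  generalize (Real.cos (Θ 0) : ℂ) = c
  generalize (Real.sin (k - Θ 1) : ℂ) = r
  linear_combination (c * s⁻¹ * r * (O 0 0 - O 1 1) + Real.sin (k - β) * (O 0 1 + O 1 0)) * I_sq +
    (O 0 1 * I * e * b' - O 1 0 * I * e' * b) * hst + O 0 1 * I * h2 - O 1 0 * I * h1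

theorem blochVec_generator_zero (β k : ℝ) (Θ : Fin 2 → ℝ) (μ : Fin 2) :
    blochVec (generator β k Θ μ) 0 = 0 := by
  rw [generator_eq_explicit]
  fin_cases μ <;> simp [blochVec, pauli, Matrix.trace_fin_two]

theorem trace_generator_mul_axis (β k : ℝ) {Θ : Fin 2 → ℝ} (hθ : Real.sin (Θ 0) ≠ 0)
    (μ : Fin 2) :
    (generator β k Θ μ * axis β k Θ).trace = -(2 * weight k Θ μ * gap k Θ : ℝ) := by
  have h := congrArg Matrix.trace (generator_anticomm_axis β k hθ μ)
  rw [Matrix.trace_add, Matrix.trace_mul_comm (axis β k Θ), Matrix.trace_smul, Matrix.trace_one,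
    smul_eq_mul, Fintype.card_fin, ofReal_neg] at h
  push_cast at h ⊢
  linear_combination h / 2

/-- `((O_μ| A |X))` in terms of the traceless part of the step. -/
theorem star_blochVec_generator_dotProduct (β k : ℝ) {Θ : Fin 2 → ℝ} (hθ : Real.sin (Θ 0) ≠ 0)
    (μ : Fin 2) (X : Matrix (Fin 2) (Fin 2) ℂ) :
    star (blochVec (generator β k Θ μ)) ⬝ᵥ
      ((projA (Θ 0) (Θ 1) β k).map (fun r : ℝ => (r : ℂ)) *ᵥ blochVec X) =
      -2 * weight k Θ μ * (X * axis β k Θ).trace := by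
  rw [star_dotProduct_projA β k hθ, blochVec_dot_axis β k hθ, blochVec_dot_axis β k hθ,
    blochVec_generator_zero, trace_generator_mul_axis β k hθ]
  have hs : (Real.sin (Θ 0) : ℂ) ≠ 0 := by exact_mod_cast hθ
  have hg : (gap k Θ : ℂ) ≠ 0 := by exact_mod_cast (gap_pos k hθ).ne'
  simp only [star_zero, zero_mul, zero_add, star_mul', star_div₀, star_neg, star_ofReal]
  rw [show star I = -I from conj_I]
  push_cast [-ofReal_sin, -ofReal_cos]
  field_simp
  simp only [I_sq]
  ring

/-! ### The derivative of the evolution in `k`-space -/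

/-- The part of the generator which commutes with `kStep`. -/
def commPart (β k : ℝ) (Θ : Fin 2 → ℝ) (μ : Fin 2) : Matrix (Fin 2) (Fin 2) ℂ :=
  (weight k Θ μ : ℂ) • axis β k Θ

/-- A solution `W` of the cohomological equation `O - P = u† W u - W`, with `O` the generator and
`P` its part commuting with `u`. -/
def corrector (β k : ℝ) (Θ : Fin 2 → ℝ) (μ : Fin 2) : Matrix (Fin 2) (Fin 2) ℂ :=
  (1 / (2 * gap k Θ) : ℂ) •
    (kStep β k Θ * axis β k Θ * (generator β k Θ μ - commPart β k Θ μ))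

theorem kStep_mul_axis (β k : ℝ) (Θ : Fin 2 → ℝ) :
    kStep β k Θ * axis β k Θ = axis β k Θ * kStep β k Θ := by
  rw [kStep_eq, add_mul, mul_add, smul_mul_assoc, mul_smul_comm, one_mul, mul_one]

theorem kStep_mul_commPart (β k : ℝ) (Θ : Fin 2 → ℝ) (μ : Fin 2) :
    kStep β k Θ * commPart β k Θ μ = commPart β k Θ μ * kStep β k Θ := by
  rw [commPart, mul_smul_comm, kStep_mul_axis, smul_mul_assoc]

theorem kStepDeriv_eq (β k : ℝ) {Θ : Fin 2 → ℝ} (hθ : Real.sin (Θ 0) ≠ 0) (μ : Fin 2) :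
    kStepDeriv β k Θ μ = kStep β k Θ * commPart β k Θ μ + corrector β k Θ μ * kStep β k Θ -
      kStep β k Θ * corrector β k Θ μ := by
  have hg : (gap k Θ : ℂ) ≠ 0 := by exact_mod_cast (gap_pos k hθ).ne'
  set V := axis β k Θ with hV
  set u := kStep β k Θ with hu
  set Q := generator β k Θ μ - commPart β k Θ μ with hQ
  have hVV : V * V = -(gap k Θ : ℂ) • 1 := axis_mul_axis β k Θ
  -- The generator and `commPart` have equal anticommutators with V, which cancel in Q.
  have hQV : Q * V = -(V * Q) := by
    have h := generator_anticomm_axis β k hθ μ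
    rw [eq_neg_iff_add_eq_zero, hQ, sub_mul, mul_sub]
    have hP : commPart β k Θ μ * V + V * commPart β k Θ μ =
        ((-(2 * weight k Θ μ * gap k Θ) : ℝ) : ℂ) • 1 := by
      rw [commPart, smul_mul_assoc, mul_smul_comm, ← hV, hVV, smul_smul, ← add_smul]
      congr 1
      push_cast
      ring
    rw [← hV] at h
    rw [sub_add_sub_comm, h, hP, sub_self]
  have huV : u = ((Real.cos (Θ 0) * Real.cos (k - Θ 1) : ℝ) : ℂ) • 1 + V := kStep_eq β k Θ
  have hcom : u * V = V * u := kStep_mul_axis β k Θ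
  have hQu : Q * u = u * Q - (2 : ℂ) • (V * Q) := by
    rw [huV, mul_add, add_mul, hQV, mul_smul_comm, smul_mul_assoc, one_mul, mul_one]
    module
  -- Moving u past Q costs -2 V Q, and V² = -`gap`; this produces the factor 2 `gap` that the
  -- normalization of `corrector` divides out.
  have hmain : u * V * Q * u - u * (u * V * Q) = (2 * gap k Θ : ℂ) • (u * Q) := by
    have h1 : u * V * Q * u = u * (u * V * Q) - (2 : ℂ) • (u * (V * V) * Q) := by
      rw [mul_assoc (u * V), hQu, mul_sub, mul_smul_comm]
      congr 1
      · rw [mul_assoc u V, ← mul_assoc V u, ← hcom]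
      · simp only [mul_assoc]
    rw [h1, hVV, mul_smul_comm, smul_mul_assoc, mul_one]
    module
  rw [← kStep_mul_generator, ← hu, add_sub_assoc, corrector, smul_mul_assoc, mul_smul_comm,
    ← smul_sub, hmain, smul_smul, one_div_mul_cancel (mul_ne_zero two_ne_zero hg), one_smul,
    ← mul_add, hQ, add_sub_cancel]

/-- The derivative of `kStep ^ t` with respect to the parameter `Θ μ`. -/
def kPowDeriv (β k : ℝ) (Θ : Fin 2 → ℝ) (μ : Fin 2) : ℕ → Matrix (Fin 2) (Fin 2) ℂ
  | 0 => 0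
  | t + 1 => kStepDeriv β k Θ μ * kStep β k Θ ^ t + kStep β k Θ * kPowDeriv β k Θ μ t

/-- Each step contributes one P, which commutes with the powers of u, while the coboundary terms
telescope and leave only the two boundary terms in W. -/
theorem kPowDeriv_eq (β k : ℝ) {Θ : Fin 2 → ℝ} (hθ : Real.sin (Θ 0) ≠ 0) (μ : Fin 2) (t : ℕ) :
    kPowDeriv β k Θ μ t = kStep β k Θ ^ t * ((t : ℂ) • commPart β k Θ μ - corrector β k Θ μ) +
      corrector β k Θ μ * kStep β k Θ ^ t := by
  induction t with
  | zero => simp [kPowDeriv]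
  | succ t ih =>
    have hcom : commPart β k Θ μ * kStep β k Θ ^ t = kStep β k Θ ^ t * commPart β k Θ μ :=
      ((show Commute _ _ from kStep_mul_commPart β k Θ μ).pow_left t).symm
    rw [kPowDeriv, ih, kStepDeriv_eq β k hθ, pow_succ', sub_mul, add_mul]
    simp only [mul_add, mul_sub, mul_assoc, hcom, mul_smul_comm, Nat.cast_succ, add_smul, one_smul]
    abel

/-! ### The derivative of the evolution on the lattice -/

theorem norm_translate (a : ℤ) (c : Position) : ‖translate a c‖ = ‖c‖ := by
  have h : 0 < (2 : ENNReal).toReal := by norm_num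
  rw [lp.norm_eq_tsum_rpow h, lp.norm_eq_tsum_rpow h]
  congr 1
  exact (Equiv.subRight a).tsum_eq fun x => ‖c x‖ ^ (2 : ENNReal).toReal

/-- `translate` as a continuous linear map. -/
def translateL (a : ℤ) : Position →L[ℂ] Position :=
  LinearMap.mkContinuous
    { toFun := translate a
      map_add' := fun _ _ => rfl
      map_smul' := fun _ _ => rfl } 1 fun c => by
    rw [one_mul]
    exact (norm_translate a c).le

/-- The Leibniz rule for one step of a walk. -/
theorem hasDerivAt_condShift_coinStep {C : ℝ → Matrix (Fin 2) (Fin 2) ℂ}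
    {C' : Matrix (Fin 2) (Fin 2) ℂ} {ψ : ℝ → Walker} {ψ' : Walker} {x : ℝ}
    (hC : ∀ i j, HasDerivAt (fun s => C s i j) (C' i j) x) (hψ : HasDerivAt ψ ψ' x) :
    HasDerivAt (fun s => condShift (coinStep (C s) (ψ s)))
      (condShift (coinStep C' (ψ x)) + condShift (coinStep (C x) ψ')) x := by
  have hψj : ∀ j, HasDerivAt (fun s => ψ s j) (ψ' j) x := fun j =>
    (PiLp.proj (𝕜 := ℝ) 2 (fun _ : Fin 2 => Position) j).hasFDerivAt.comp_hasDerivAt x hψ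
  have hsum : ∀ i, HasDerivAt (fun s => ∑ j, C s i j • ψ s j)
      (∑ j, (C x i j • ψ' j + C' i j • ψ x j)) x := fun i =>
    HasDerivAt.fun_sum fun j _ => (hC i j).smul (hψj j)
  have htr : ∀ a i, HasDerivAt (fun s => translate a (∑ j, C s i j • ψ s j))
      (translate a (∑ j, (C x i j • ψ' j + C' i j • ψ x j))) x := fun a i =>
    ((translateL a).restrictScalars ℝ).hasFDerivAt.comp_hasDerivAt x (hsum i)
  have hpi : HasDerivAt
      (fun s => (![translate 1 (∑ j, C s 0 j • ψ s j), translate (-1) (∑ j, C s 1 j • ψ s j)] :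
        Fin 2 → Position))
      ![translate 1 (∑ j, (C x 0 j • ψ' j + C' 0 j • ψ x j)),
        translate (-1) (∑ j, (C x 1 j • ψ' j + C' 1 j • ψ x j))] x := by
    rw [hasDerivAt_pi]
    intro i
    fin_cases i
    · exact htr 1 0
    · exact htr (-1) 1
  refine ((PiLp.continuousLinearEquiv 2 ℝ (fun _ : Fin 2 => Position)).symm :
    (Fin 2 → Position) →L[ℝ] Walker).hasFDerivAt.comp_hasDerivAt x hpi |>.congr_deriv ?_
  have hadd : ∀ a i, translate a (∑ j, (C x i j • ψ' j + C' i j • ψ x j)) =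
      translate a (∑ j, C' i j • ψ x j) + translate a (∑ j, C x i j • ψ' j) := fun a i => by
    rw [Finset.sum_add_distrib, add_comm]
    rfl
  simp only [hadd]
  refine PiLp.ext fun i => ?_
  fin_cases i <;> rfl

/-- The derivative of `evolve` with respect to the parameter `Θ μ`. -/
def evolveDeriv (β : ℝ) (Θ : Fin 2 → ℝ) (μ : Fin 2) (Ψ : Walker) : ℕ → Walker
  | 0 => 0
  | t + 1 => condShift (coinStep (coinDeriv β Θ μ) (evolve β Θ t Ψ)) +
      step β Θ (evolveDeriv β Θ μ Ψ t)

theorem evolve_succ (β : ℝ) (Θ : Fin 2 → ℝ) (t : ℕ) (Ψ : Walker) :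
    evolve β Θ (t + 1) Ψ = step β Θ (evolve β Θ t Ψ) :=
  Function.iterate_succ_apply' _ _ _

theorem hasDerivAt_evolve (β : ℝ) (Θ : Fin 2 → ℝ) (μ : Fin 2) (Ψ : Walker) (t : ℕ) :
    HasDerivAt (fun s : ℝ => evolve β (Function.update Θ μ s) t Ψ) (evolveDeriv β Θ μ Ψ t)
      (Θ μ) := by
  induction t with
  | zero => exact hasDerivAt_const _ _
  | succ t ih =>
    simp only [evolve_succ]
    have h := hasDerivAt_condShift_coinStep (hasDerivAt_coin β Θ μ) ih
    simp only [Function.update_eq_self] at h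
    exact h

theorem amplitude_evolve (β : ℝ) (Θ : Fin 2 → ℝ) (t : ℕ) (Ψ : Walker) :
    ∀ᵐ k : ℝ, amplitude (evolve β Θ t Ψ) k = (kStep β k Θ ^ t) *ᵥ amplitude Ψ k := by
  induction t with
  | zero => exact ae_of_all _ fun k => by simp [evolve]
  | succ t ih =>
    filter_upwards [ih, amplitude_condShift_coinStep (coin (Θ 0) (Θ 1) β) (evolve β Θ t Ψ)]
      with k h1 h2
    rw [evolve_succ, step, h2, h1, Matrix.mulVec_mulVec, pow_succ']
    rfl

theorem amplitude_evolveDeriv (β : ℝ) (Θ : Fin 2 → ℝ) (μ : Fin 2) (t : ℕ) (Ψ : Walker) :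
    ∀ᵐ k : ℝ, amplitude (evolveDeriv β Θ μ Ψ t) k = kPowDeriv β k Θ μ t *ᵥ amplitude Ψ k := by
  induction t with
  | zero =>
    -- An amplitude is a representative of an L² class, so that of the zero state vanishes only
    -- almost everywhere; homogeneity with the scalar 0 gives this.
    filter_upwards [amplitude_smul 0 (0 : Walker) 0, amplitude_smul 0 (0 : Walker) 1] with k h0 h1
    rw [zero_smul, zero_mul] at h0 h1
    ext i
    fin_cases i
    · simpa [evolveDeriv, kPowDeriv] using h0
    · simpa [evolveDeriv, kPowDeriv] using h1
  | succ t ih =>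
    have hadd := fun i => amplitude_add
      (condShift (coinStep (coinDeriv β Θ μ) (evolve β Θ t Ψ)))
      (step β Θ (evolveDeriv β Θ μ Ψ t)) i
    filter_upwards [ih, amplitude_evolve β Θ t Ψ, hadd 0, hadd 1,
      amplitude_condShift_coinStep (coin (Θ 0) (Θ 1) β) (evolveDeriv β Θ μ Ψ t),
      amplitude_condShift_coinStep (coinDeriv β Θ μ) (evolve β Θ t Ψ)] with k h1 h2 h3 h4 h5 h6
    have h7 : amplitude (evolveDeriv β Θ μ Ψ (t + 1)) k =
        amplitude (condShift (coinStep (coinDeriv β Θ μ) (evolve β Θ t Ψ))) k +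
          amplitude (step β Θ (evolveDeriv β Θ μ Ψ t)) k := by
      ext i
      fin_cases i
      · exact h3
      · exact h4
    rw [h7, step, h5, h6, h1, h2, kPowDeriv, Matrix.add_mulVec, Matrix.mulVec_mulVec,
      Matrix.mulVec_mulVec]
    rfl

/-! ### Symmetric logarithmic derivatives of a pure-state model -/

/-- The rank-one operator is conjugate-linear in one argument, so bilinearity, and with it the
product rule, holds over ℝ only. -/
theorem isBoundedBilinearMap_rankOne :
    IsBoundedBilinearMap ℝ fun p : Walker × Walker => InnerProductSpace.rankOne ℂ p.1 p.2 where
  add_left _ _ _ := by simp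
  smul_left c x y := by
    simp only [RCLike.real_smul_eq_coe_smul (K := ℂ), map_smul, smul_apply]
  add_right _ _ _ := by simp
  smul_right c x y := by
    simp only [RCLike.real_smul_eq_coe_smul (K := ℂ), map_smulₛₗ, RCLike.conj_ofReal]
  bound := ⟨1, one_pos, fun x y => by simp⟩

theorem hasDerivAt_density {ψ : ℝ → Walker} {ψ' : Walker} {x : ℝ} (hψ : HasDerivAt ψ ψ' x) :
    HasDerivAt (fun s => density (ψ s))
      (InnerProductSpace.rankOne ℂ (ψ x) ψ' + InnerProductSpace.rankOne ℂ ψ' (ψ x)) x := by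
  have h := (isBoundedBilinearMap_rankOne.hasFDerivAt (ψ x, ψ x)).comp_hasDerivAt x
    (hψ.prodMk hψ)
  exact h

theorem star_mulVec_dotProduct_mulVec {U : Matrix (Fin 2) (Fin 2) ℂ}
    (hU : U ∈ Matrix.unitaryGroup (Fin 2) ℂ) (x y : Fin 2 → ℂ) :
    star (U *ᵥ x) ⬝ᵥ (U *ᵥ y) = star x ⬝ᵥ y := by
  rw [Matrix.star_mulVec, Matrix.dotProduct_mulVec, Matrix.vecMul_vecMul,
    ← Matrix.star_eq_conjTranspose, Matrix.mem_unitaryGroup_iff'.1 hU, Matrix.vecMul_one]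

theorem star_amplitude_dotProduct_of_isProbe {Ψ : Walker} (hΨ : IsProbe Ψ) :
    ∀ᵐ k : ℝ, star (amplitude Ψ k) ⬝ᵥ amplitude Ψ k = 1 := by
  filter_upwards [hΨ] with k hk
  rw [← hk, initialState, Matrix.trace_vecMulVec, dotProduct_comm]

theorem inner_evolve_of_isProbe {Ψ : Walker} (hΨ : IsProbe Ψ) (β : ℝ) (Θ : Fin 2 → ℝ) (t : ℕ) :
    inner ℂ (evolve β Θ t Ψ) (evolve β Θ t Ψ) = (1 : ℂ) := by
  rw [inner_eq_integral, intervalIntegral.integral_congr_ae (g := fun _ => (1 : ℂ))]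
  · have : (Real.pi : ℂ) ≠ 0 := by exact_mod_cast Real.pi_ne_zero
    rw [intervalIntegral.integral_const, Complex.real_smul]
    push_cast
    field_simp
    ring
  · filter_upwards [star_amplitude_dotProduct_of_isProbe hΨ, amplitude_evolve β Θ t Ψ]
      with k hk h _
    rw [h, star_mulVec_dotProduct_mulVec (pow_mem (kStep_mem_unitary β k Θ) t), hk]

/-- The norm is 1 for every value of the parameter, so its derivative vanishes. -/
theorem inner_evolve_evolveDeriv_add {Ψ : Walker} (hΨ : IsProbe Ψ) (β : ℝ) (Θ : Fin 2 → ℝ)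
    (μ : Fin 2) (t : ℕ) :
    inner ℂ (evolve β Θ t Ψ) (evolveDeriv β Θ μ Ψ t) +
      inner ℂ (evolveDeriv β Θ μ Ψ t) (evolve β Θ t Ψ) = 0 := by
  have h := hasDerivAt_evolve β Θ μ Ψ t
  have h1 := h.inner ℂ h
  simp only [inner_evolve_of_isProbe hΨ, Function.update_eq_self] at h1
  exact h1.unique (hasDerivAt_const _ _)

theorem hasDerivAt_density_evolve (β : ℝ) (Θ : Fin 2 → ℝ) (μ : Fin 2) (Ψ : Walker) (t : ℕ) :
    HasDerivAt (fun s : ℝ => density (evolve β (Function.update Θ μ s) t Ψ))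
      (InnerProductSpace.rankOne ℂ (evolve β Θ t Ψ) (evolveDeriv β Θ μ Ψ t) +
        InnerProductSpace.rankOne ℂ (evolveDeriv β Θ μ Ψ t) (evolve β Θ t Ψ)) (Θ μ) := by
  have h := hasDerivAt_density (hasDerivAt_evolve β Θ μ Ψ t)
  simp only [Function.update_eq_self] at h
  exact h

/-- The symmetric logarithmic derivative is determined on the state. -/
theorem IsSLD.apply_evolve {β : ℝ} {Θ : Fin 2 → ℝ} {t : ℕ} {Ψ : Walker} {μ : Fin 2} {L : Op}
    (hΨ : IsProbe Ψ) (hL : IsSLD β Θ t Ψ μ L) :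
    L (evolve β Θ t Ψ) = (2 : ℂ) • (evolveDeriv β Θ μ Ψ t +
      (inner ℂ (evolveDeriv β Θ μ Ψ t) (evolve β Θ t Ψ) : ℂ) • evolve β Θ t Ψ) := by
  have hn := inner_evolve_of_isProbe hΨ β Θ t
  have h0 := inner_evolve_evolveDeriv_add hΨ β Θ μ t
  have h := hL.2.unique (hasDerivAt_density_evolve β Θ μ Ψ t)
  set ψ := evolve β Θ t Ψ
  set ψ' := evolveDeriv β Θ μ Ψ t
  have h1 := congrArg (fun A : Op => A ψ) h
  simp only [density, smul_apply, add_apply,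
    mul_apply_eq_comp, InnerProductSpace.rankOne_apply, hn, one_smul,
    RCLike.real_smul_eq_coe_smul (K := ℂ)] at h1
  -- Pairing the SLD equation with ψ gives ⟨ψ, Lψ⟩ = ⟨ψ, ψ'⟩ + ⟨ψ', ψ⟩ = 0, and the equation applied
  -- to ψ then determines Lψ.
  have h2 : inner ℂ ψ (L ψ) = (0 : ℂ) := by
    have h3 := congrArg (fun x : Walker => inner ℂ ψ x) h1
    simp only [inner_smul_right, inner_add_right, hn] at h3
    rw [mul_one, mul_one, ← two_mul, add_comm, h0] at h3
    simpa using h3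
  rw [h2, zero_smul, add_zero] at h1
  rw [add_comm, ← h1, smul_smul]
  norm_num

theorem hasSLDs_of_isProbe {Ψ : Walker} (hΨ : IsProbe Ψ) (β : ℝ) (Θ : Fin 2 → ℝ) :
    HasSLDs β Θ Ψ := by
  intro t μ
  have hn := inner_evolve_of_isProbe hΨ β Θ t
  have h0 := inner_evolve_evolveDeriv_add hΨ β Θ μ t
  have h := hasDerivAt_density_evolve β Θ μ Ψ t
  set ψ := evolve β Θ t Ψ with hψ
  set ψ' := evolveDeriv β Θ μ Ψ t
  -- For a projection, ϱ² = ϱ differentiates to ∂ϱ = ϱ ∂ϱ + ∂ϱ ϱ, so L = 2 ∂ϱ is a symmetric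
  -- logarithmic derivative.
  refine ⟨(2 : ℝ) • (InnerProductSpace.rankOne ℂ ψ ψ' + InnerProductSpace.rankOne ℂ ψ' ψ), ?_, ?_⟩
  · rw [ContinuousLinearMap.isSelfAdjoint_iff_isSymmetric]
    intro x y
    simp [inner_smul_left, inner_smul_right, inner_add_left, inner_add_right,
      RCLike.real_smul_eq_coe_smul (K := ℂ), map_ofNat]
    ring
  · refine h.congr_deriv ?_
    rw [← hψ]
    ext1 x
    simp only [density, smul_apply, add_apply,
      mul_apply_eq_comp, InnerProductSpace.rankOne_apply, hn, one_smul,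
      RCLike.real_smul_eq_coe_smul (K := ℂ), inner_smul_right, inner_add_right, map_smul]
    push_cast
    rw [eq_neg_of_add_eq_zero_right h0]
    module

/-- The SLD maps ψ to twice the component of ∂ψ orthogonal to ψ. Although `L` and `M` need not be
unique, this overlap is. -/
theorem inner_sld {β : ℝ} {Θ : Fin 2 → ℝ} {t : ℕ} {Ψ : Walker} {μ ν : Fin 2} {L M : Op}
    (hΨ : IsProbe Ψ) (hL : IsSLD β Θ t Ψ μ L) (hM : IsSLD β Θ t Ψ ν M) :
    inner ℂ (L (evolve β Θ t Ψ)) (M (evolve β Θ t Ψ)) =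
      4 * (inner ℂ (evolveDeriv β Θ μ Ψ t) (evolveDeriv β Θ ν Ψ t) -
        star (inner ℂ (evolve β Θ t Ψ) (evolveDeriv β Θ μ Ψ t)) *
          inner ℂ (evolve β Θ t Ψ) (evolveDeriv β Θ ν Ψ t) : ℂ) := by
  have hn := inner_evolve_of_isProbe hΨ β Θ t
  have h0 := inner_evolve_evolveDeriv_add hΨ β Θ ν t
  rw [hL.apply_evolve hΨ, hM.apply_evolve hΨ, RCLike.star_def, inner_conj_symm]
  simp only [inner_smul_left, inner_smul_right, inner_add_left, inner_add_right, hn,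
    inner_conj_symm, map_ofNat]
  rw [eq_neg_of_add_eq_zero_right h0]
  ring

theorem qfi_eq_re {ψ : Walker} {L M : Op} (hL : IsSelfAdjoint L) (hM : IsSelfAdjoint M) :
    qfi ψ L M = (inner ℂ (L ψ) (M ψ) : ℂ).re := by
  have hL' := (ContinuousLinearMap.isSelfAdjoint_iff_isSymmetric.1 hL) ψ (M ψ)
  have hM' := (ContinuousLinearMap.isSelfAdjoint_iff_isSymmetric.1 hM) ψ (L ψ)
  simp only [ContinuousLinearMap.coe_coe] at hL' hM'
  rw [qfi, add_apply, mul_apply_eq_comp,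
    mul_apply_eq_comp, inner_add_right, ← hL', ← hM', ← inner_conj_symm (M ψ) (L ψ)]
  simp [-inner_conj_symm]
  ring

theorem uhlmann_eq_im {ψ : Walker} {L M : Op} (hL : IsSelfAdjoint L) (hM : IsSelfAdjoint M) :
    uhlmann ψ L M = (inner ℂ (L ψ) (M ψ) : ℂ).im := by
  have hL' := (ContinuousLinearMap.isSelfAdjoint_iff_isSymmetric.1 hL) ψ (M ψ)
  have hM' := (ContinuousLinearMap.isSelfAdjoint_iff_isSymmetric.1 hM) ψ (L ψ)
  simp only [ContinuousLinearMap.coe_coe] at hL' hM'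
  rw [uhlmann, sub_apply, mul_apply_eq_comp,
    mul_apply_eq_comp, inner_sub_right, ← hL', ← hM', ← inner_conj_symm (M ψ) (L ψ)]
  simp [-inner_conj_symm]
  ring

/-! ### Continuity in `k` -/

theorem continuous_kStep (β : ℝ) (Θ : Fin 2 → ℝ) : Continuous fun k => kStep β k Θ := by
  refine Continuous.matrix_mul (continuous_matrix fun i j => ?_) continuous_const
  fin_cases i <;> fin_cases j <;> simp <;> fun_prop

theorem continuous_axis (β : ℝ) (Θ : Fin 2 → ℝ) : Continuous fun k => axis β k Θ := by
  refine continuous_matrix fun i j => ?_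
  fin_cases i <;> fin_cases j <;> simp [axis] <;> fun_prop

theorem continuous_generator (β : ℝ) (Θ : Fin 2 → ℝ) (μ : Fin 2) :
    Continuous fun k => generator β k Θ μ := by
  simp only [generator_eq_explicit]
  exact continuous_const

theorem continuous_gap (Θ : Fin 2 → ℝ) : Continuous fun k => gap k Θ := by
  unfold gap
  fun_prop

theorem continuous_weight {Θ : Fin 2 → ℝ} (hθ : Real.sin (Θ 0) ≠ 0) (μ : Fin 2) :
    Continuous fun k => weight k Θ μ := by
  refine Continuous.div ?_ (continuous_gap Θ) fun k => (gap_pos k hθ).ne'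
  fin_cases μ <;> simp <;> fun_prop

theorem continuous_commPart (β : ℝ) {Θ : Fin 2 → ℝ} (hθ : Real.sin (Θ 0) ≠ 0) (μ : Fin 2) :
    Continuous fun k => commPart β k Θ μ :=
  (continuous_ofReal.comp (continuous_weight hθ μ)).smul (continuous_axis β Θ)

theorem continuous_corrector (β : ℝ) {Θ : Fin 2 → ℝ} (hθ : Real.sin (Θ 0) ≠ 0) (μ : Fin 2) :
    Continuous fun k => corrector β k Θ μ := by
  refine Continuous.smul (Continuous.div continuous_const
    (continuous_const.mul (continuous_ofReal.comp (continuous_gap Θ))) fun k => ?_)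
    (((continuous_kStep β Θ).mul (continuous_axis β Θ)).mul
      ((continuous_generator β Θ μ).sub (continuous_commPart β hθ μ)))
  exact mul_ne_zero two_ne_zero (ofReal_ne_zero.2 (gap_pos k hθ).ne')

/-! ### Dominated convergence in `k`-space -/

theorem norm_amplitude_le_of_dotProduct {φ : Fin 2 → ℂ} (h : star φ ⬝ᵥ φ = 1) (i : Fin 2) :
    ‖φ i‖ ≤ 1 := by
  have h1 : ‖φ 0‖ ^ 2 + ‖φ 1‖ ^ 2 = 1 := by
    have h2 : ∀ z : ℂ, star z * z = ((‖z‖ ^ 2 : ℝ) : ℂ) := fun z => by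
      rw [RCLike.star_def, Complex.conj_mul']; push_cast; rfl
    simp only [dotProduct, Fin.sum_univ_two, Pi.star_apply, h2] at h
    exact_mod_cast h
  fin_cases i
  · exact (sq_le_one_iff₀ (norm_nonneg _)).1 (by simpa using by nlinarith [sq_nonneg ‖φ 1‖])
  · exact (sq_le_one_iff₀ (norm_nonneg _)).1 (by simpa using by nlinarith [sq_nonneg ‖φ 0‖])

theorem norm_mulVec_le {M : Matrix (Fin 2) (Fin 2) ℂ} {φ : Fin 2 → ℂ} {b : ℝ}
    (hM : ∀ i j, ‖M i j‖ ≤ b) (hφ : ∀ i, ‖φ i‖ ≤ 1) (i : Fin 2) : ‖(M *ᵥ φ) i‖ ≤ 2 * b := by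
  have h : ∀ j, ‖M i j * φ j‖ ≤ b := fun j => by
    rw [norm_mul]
    nlinarith [hM i j, hφ j, norm_nonneg (M i j), norm_nonneg (φ j)]
  rw [Matrix.mulVec, dotProduct, Fin.sum_univ_two, two_mul]
  exact (norm_add_le _ _).trans (add_le_add (h 0) (h 1))

/-- Dominated convergence for matrix-valued symbols applied to the amplitude of a probe. -/
theorem tendsto_integral_star_mulVec_dotProduct {Ψ : Walker} (hΨ : IsProbe Ψ)
    {M N : ℕ → ℝ → Matrix (Fin 2) (Fin 2) ℂ} {M' N' : ℝ → Matrix (Fin 2) (Fin 2) ℂ} {b : ℝ → ℝ}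
    (hM : ∀ t, Continuous (M t)) (hN : ∀ t, Continuous (N t)) (hb : Continuous b)
    (hMb : ∀ t k i j, ‖M t k i j‖ ≤ b k) (hNb : ∀ t k i j, ‖N t k i j‖ ≤ b k)
    (hM' : ∀ k, Tendsto (fun t => M t k) atTop (𝓝 (M' k)))
    (hN' : ∀ k, Tendsto (fun t => N t k) atTop (𝓝 (N' k))) :
    Tendsto (fun t => ∫ k in (-Real.pi)..Real.pi,
        star (M t k *ᵥ amplitude Ψ k) ⬝ᵥ (N t k *ᵥ amplitude Ψ k)) atTop
      (𝓝 (∫ k in (-Real.pi)..Real.pi,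
        star (M' k *ᵥ amplitude Ψ k) ⬝ᵥ (N' k *ᵥ amplitude Ψ k))) := by
  refine intervalIntegral.tendsto_integral_filter_of_dominated_convergence
    -- Each entry of a matrix–vector product is at most 2 b, and the dot product has two terms.
    (fun k => 2 * (2 * b k * (2 * b k))) (Eventually.of_forall fun t => ?_)
    (Eventually.of_forall fun t => ?_) (Continuous.intervalIntegrable (by fun_prop) _ _) ?_
  · have hmv : ∀ {A : ℝ → Matrix (Fin 2) (Fin 2) ℂ}, Continuous A → ∀ i,
        AEStronglyMeasurable (fun k => (A k *ᵥ amplitude Ψ k) i) := fun {A} hA i => by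
      have hj : ∀ j, AEStronglyMeasurable fun k => A k i j * amplitude Ψ k j := fun j =>
        (hA.matrix_elem i j).aestronglyMeasurable.mul (aestronglyMeasurable_amplitude Ψ j)
      refine ((hj 0).add (hj 1)).congr (ae_of_all _ fun k => ?_)
      simp [Matrix.mulVec, dotProduct, Fin.sum_univ_two]
    have hi : ∀ i, AEStronglyMeasurable fun k =>
        star ((M t k *ᵥ amplitude Ψ k) i) * (N t k *ᵥ amplitude Ψ k) i := fun i =>
      (continuous_star.comp_aestronglyMeasurable (hmv (hM t) i)).mul (hmv (hN t) i)
    have := (hi 0).add (hi 1)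
    refine AEStronglyMeasurable.restrict (this.congr (ae_of_all _ fun k => ?_))
    simp [dotProduct, Fin.sum_univ_two]
  · filter_upwards [star_amplitude_dotProduct_of_isProbe hΨ] with k hk _
    have hφ := norm_amplitude_le_of_dotProduct hk
    have hi : ∀ i, ‖star ((M t k *ᵥ amplitude Ψ k) i) * (N t k *ᵥ amplitude Ψ k) i‖ ≤
        2 * b k * (2 * b k) := fun i => by
      rw [norm_mul, norm_star]
      have h1 := norm_mulVec_le (hMb t k) hφ i
      exact mul_le_mul h1 (norm_mulVec_le (hNb t k) hφ i) (norm_nonneg _)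
        ((norm_nonneg _).trans h1)
    rw [dotProduct, Fin.sum_univ_two, two_mul (2 * b k * (2 * b k))]
    exact (norm_add_le _ _).trans (add_le_add (hi 0) (hi 1))
  · refine ae_of_all _ fun k _ => ?_
    generalize amplitude Ψ k = φ
    have hc : Continuous fun p : Matrix (Fin 2) (Fin 2) ℂ × Matrix (Fin 2) (Fin 2) ℂ =>
        star (p.1 *ᵥ φ) ⬝ᵥ (p.2 *ᵥ φ) := by fun_prop
    have hT : Tendsto (fun t => (M t k, N t k)) atTop (𝓝 (M' k, N' k)) :=
      (hM' k).prodMk_nhds (hN' k)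
    have h1 := hc.tendsto (M' k, N' k)
    have h2 := h1.comp hT
    exact h2

/-! ### The rescaled derivative of the evolution -/

/-- `u^{-t} ∂_μ(u^t) / t` for `t ≠ 0`. -/
def meanGenerator (β : ℝ) (Θ : Fin 2 → ℝ) (μ : Fin 2) (t : ℕ) (k : ℝ) :
    Matrix (Fin 2) (Fin 2) ℂ :=
  commPart β k Θ μ + ((t : ℂ)⁻¹) •
    ((kStep β k Θ ^ t)ᴴ * corrector β k Θ μ * kStep β k Θ ^ t - corrector β k Θ μ)

theorem kPowDeriv_eq_smul_meanGenerator (β k : ℝ) {Θ : Fin 2 → ℝ} (hθ : Real.sin (Θ 0) ≠ 0)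
    (μ : Fin 2) {t : ℕ} (ht : t ≠ 0) :
    kPowDeriv β k Θ μ t = kStep β k Θ ^ t * ((t : ℂ) • meanGenerator β Θ μ t k) := by
  have ht' : (t : ℂ) ≠ 0 := by exact_mod_cast ht
  have hu : kStep β k Θ ^ t * (kStep β k Θ ^ t)ᴴ = 1 :=
    Matrix.mem_unitaryGroup_iff.1 (pow_mem (kStep_mem_unitary β k Θ) t)
  rw [kPowDeriv_eq β k hθ, meanGenerator, smul_add, smul_smul, mul_inv_cancel₀ ht', one_smul,
    mul_add, mul_sub, mul_sub, ← mul_assoc, ← mul_assoc, hu, one_mul]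
  abel

theorem continuous_meanGenerator (β : ℝ) {Θ : Fin 2 → ℝ} (hθ : Real.sin (Θ 0) ≠ 0) (μ : Fin 2)
    (t : ℕ) : Continuous (meanGenerator β Θ μ t) := by
  have hu : Continuous fun k => kStep β k Θ ^ t := (continuous_kStep β Θ).pow t
  have hW := continuous_corrector β hθ μ
  have h : Continuous fun k => (kStep β k Θ ^ t)ᴴ * corrector β k Θ μ * kStep β k Θ ^ t -
      corrector β k Θ μ := ((hu.matrix_conjTranspose.mul hW).mul hu).sub hW
  exact (continuous_commPart β hθ μ).add (h.const_smul ((t : ℂ)⁻¹))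

/-- The sum of the absolute values of the entries of a matrix. -/
def entrySum (A : Matrix (Fin 2) (Fin 2) ℂ) : ℝ := ∑ a, ∑ b, ‖A a b‖

theorem entrySum_nonneg (A : Matrix (Fin 2) (Fin 2) ℂ) : 0 ≤ entrySum A :=
  Finset.sum_nonneg fun _ _ => Finset.sum_nonneg fun _ _ => norm_nonneg _

theorem norm_apply_le_entrySum (A : Matrix (Fin 2) (Fin 2) ℂ) (i j : Fin 2) :
    ‖A i j‖ ≤ entrySum A :=
  (Finset.single_le_sum (f := fun b => ‖A i b‖)
    (fun _ _ => norm_nonneg _) (Finset.mem_univ j)).trans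
    (Finset.single_le_sum (f := fun a => ∑ b, ‖A a b‖)
      (fun _ _ => Finset.sum_nonneg fun _ _ => norm_nonneg _) (Finset.mem_univ i))

theorem continuous_entrySum : Continuous entrySum :=
  continuous_finsetSum _ fun a _ => continuous_finsetSum _ fun b _ =>
    (continuous_id.matrix_elem a b).norm

/-- Entries of a unitary matrix have modulus at most 1. Applied to u^t, this bounds the conjugated
corrector uniformly in t. -/
theorem norm_unitary_conj_le {U : Matrix (Fin 2) (Fin 2) ℂ}
    (hU : U ∈ Matrix.unitaryGroup (Fin 2) ℂ) (W : Matrix (Fin 2) (Fin 2) ℂ) (i j : Fin 2) :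
    ‖(Uᴴ * W * U) i j‖ ≤ entrySum W := by
  have hle : ∀ a b, ‖U a b‖ ≤ 1 := entry_norm_bound_of_unitary hU
  simp only [Matrix.mul_apply, Finset.sum_mul, Matrix.conjTranspose_apply]
  rw [Finset.sum_comm]
  refine norm_sum_le_of_le _ fun a _ => norm_sum_le_of_le _ fun b _ => ?_
  rw [norm_mul, norm_mul, norm_star]
  have h1 := mul_le_mul_of_nonneg_right (hle a i) (norm_nonneg (W a b))
  have h2 := mul_le_mul h1 (hle b j) (norm_nonneg _) (by positivity)
  simpa using h2

theorem norm_meanGenerator_sub_le (β k : ℝ) (Θ : Fin 2 → ℝ) (μ : Fin 2) (t : ℕ) (i j : Fin 2) :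
    ‖(meanGenerator β Θ μ t k - commPart β k Θ μ) i j‖ ≤
      (t : ℝ)⁻¹ * (2 * entrySum (corrector β k Θ μ)) := by
  -- At t = 0 the inverse is 0 and both sides vanish, so no exception is needed.
  rw [meanGenerator, add_sub_cancel_left, Matrix.smul_apply, norm_smul, norm_inv, norm_natCast]
  refine mul_le_mul_of_nonneg_left ?_ (by positivity)
  rw [Matrix.sub_apply, two_mul]
  exact (norm_sub_le _ _).trans (add_le_add
    (norm_unitary_conj_le (pow_mem (kStep_mem_unitary β k Θ) t) _ i j)
    (norm_apply_le_entrySum _ i j))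

theorem tendsto_meanGenerator (β k : ℝ) (Θ : Fin 2 → ℝ) (μ : Fin 2) :
    Tendsto (fun t => meanGenerator β Θ μ t k) atTop (𝓝 (commPart β k Θ μ)) := by
  refine tendsto_pi_nhds.2 fun i => tendsto_pi_nhds.2 fun j => ?_
  rw [tendsto_iff_norm_sub_tendsto_zero]
  refine squeeze_zero (fun _ => norm_nonneg _)
    (fun t => norm_meanGenerator_sub_le β k Θ μ t i j) ?_
  simpa using (tendsto_inv_atTop_nhds_zero_nat (𝕜 := ℝ)).mul_const
    (2 * entrySum (corrector β k Θ μ))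

/-- A common bound, continuous in `k`, for the entries of all `meanGenerator`s. -/
def meanBound (β : ℝ) (Θ : Fin 2 → ℝ) (k : ℝ) : ℝ :=
  1 + ∑ μ, (entrySum (commPart β k Θ μ) + 2 * entrySum (corrector β k Θ μ))

theorem continuous_meanBound (β : ℝ) {Θ : Fin 2 → ℝ} (hθ : Real.sin (Θ 0) ≠ 0) :
    Continuous (meanBound β Θ) :=
  continuous_const.add <| continuous_finsetSum _ fun μ _ =>
    (continuous_entrySum.comp (continuous_commPart β hθ μ)).add
      (continuous_const.mul (continuous_entrySum.comp (continuous_corrector β hθ μ)))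

theorem meanBound_summand_nonneg (β k : ℝ) (Θ : Fin 2 → ℝ) (μ : Fin 2) :
    0 ≤ entrySum (commPart β k Θ μ) + 2 * entrySum (corrector β k Θ μ) :=
  add_nonneg (entrySum_nonneg _) (mul_nonneg zero_le_two (entrySum_nonneg _))

/-- The summand 1 lets the same bound dominate the identity matrix, which takes the place of one
symbol in ⟨ψ|∂ψ⟩. -/
theorem one_le_meanBound (β : ℝ) (Θ : Fin 2 → ℝ) (k : ℝ) : 1 ≤ meanBound β Θ k :=
  le_add_of_nonneg_right (Finset.sum_nonneg fun μ _ => meanBound_summand_nonneg β k Θ μ)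

theorem norm_meanGenerator_le (β : ℝ) (Θ : Fin 2 → ℝ) (μ : Fin 2) (t : ℕ) (k : ℝ) (i j : Fin 2) :
    ‖meanGenerator β Θ μ t k i j‖ ≤ meanBound β Θ k := by
  have h1 := norm_meanGenerator_sub_le β k Θ μ t i j
  have h2 : ‖meanGenerator β Θ μ t k i j‖ ≤ ‖commPart β k Θ μ i j‖ +
      ‖(meanGenerator β Θ μ t k - commPart β k Θ μ) i j‖ := by
    rw [Matrix.sub_apply]
    exact norm_le_norm_add_norm_sub' _ _
  have h3 := norm_apply_le_entrySum (commPart β k Θ μ) i j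
  have h4 : (t : ℝ)⁻¹ * (2 * entrySum (corrector β k Θ μ)) ≤
      2 * entrySum (corrector β k Θ μ) :=
    mul_le_of_le_one_left (mul_nonneg zero_le_two (entrySum_nonneg _)) (Nat.cast_inv_le_one t)
  have h5 := Finset.single_le_sum
    (f := fun μ => entrySum (commPart β k Θ μ) + 2 * entrySum (corrector β k Θ μ))
    (fun μ _ => meanBound_summand_nonneg β k Θ μ) (Finset.mem_univ μ)
  rw [meanBound]
  linarith

/-- The common unitary factor u^t drops out of the Parseval integrand. -/
theorem inner_evolveDeriv_evolveDeriv (β : ℝ) {Θ : Fin 2 → ℝ} (hθ : Real.sin (Θ 0) ≠ 0)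
    (μ ν : Fin 2) (Ψ : Walker) {t : ℕ} (ht : t ≠ 0) :
    (inner ℂ (evolveDeriv β Θ μ Ψ t) (evolveDeriv β Θ ν Ψ t) : ℂ) =
      (t : ℂ) ^ 2 * ((1 / (2 * Real.pi) : ℂ) * ∫ k in (-Real.pi)..Real.pi,
        star (meanGenerator β Θ μ t k *ᵥ amplitude Ψ k) ⬝ᵥ
          (meanGenerator β Θ ν t k *ᵥ amplitude Ψ k)) := by
  rw [inner_eq_integral, mul_left_comm, ← intervalIntegral.integral_const_mul ((t : ℂ) ^ 2)]
  congr 1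
  refine intervalIntegral.integral_congr_ae ?_
  filter_upwards [amplitude_evolveDeriv β Θ μ t Ψ, amplitude_evolveDeriv β Θ ν t Ψ]
    with k h1 h2 _
  rw [h1, h2, kPowDeriv_eq_smul_meanGenerator β k hθ μ ht,
    kPowDeriv_eq_smul_meanGenerator β k hθ ν ht, ← Matrix.mulVec_mulVec, ← Matrix.mulVec_mulVec,
    star_mulVec_dotProduct_mulVec (pow_mem (kStep_mem_unitary β k Θ) t), Matrix.smul_mulVec,
    Matrix.smul_mulVec, star_smul, smul_dotProduct, dotProduct_smul, smul_eq_mul, smul_eq_mul,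
    star_natCast]
  ring

theorem inner_evolve_evolveDeriv (β : ℝ) {Θ : Fin 2 → ℝ} (hθ : Real.sin (Θ 0) ≠ 0)
    (μ : Fin 2) (Ψ : Walker) {t : ℕ} (ht : t ≠ 0) :
    (inner ℂ (evolve β Θ t Ψ) (evolveDeriv β Θ μ Ψ t) : ℂ) =
      (t : ℂ) * ((1 / (2 * Real.pi) : ℂ) * ∫ k in (-Real.pi)..Real.pi,
        star ((1 : Matrix (Fin 2) (Fin 2) ℂ) *ᵥ amplitude Ψ k) ⬝ᵥ
          (meanGenerator β Θ μ t k *ᵥ amplitude Ψ k)) := by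
  rw [inner_eq_integral, mul_left_comm, ← intervalIntegral.integral_const_mul (t : ℂ)]
  congr 1
  refine intervalIntegral.integral_congr_ae ?_
  filter_upwards [amplitude_evolve β Θ t Ψ, amplitude_evolveDeriv β Θ μ t Ψ] with k h1 h2 _
  rw [h1, h2, kPowDeriv_eq_smul_meanGenerator β k hθ μ ht, ← Matrix.mulVec_mulVec,
    star_mulVec_dotProduct_mulVec (pow_mem (kStep_mem_unitary β k Θ) t), Matrix.smul_mulVec,
    dotProduct_smul, smul_eq_mul, Matrix.one_mulVec]

/-! ### Evaluation of the limits -/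

/-- Since V† V = `gap`, the product P_μ† P_ν is a scalar, and the state enters only through the norm
of its amplitude at k, which is 1 for a probe. -/
theorem integral_commPart_eq_freeTerm {Ψ : Walker} (hΨ : IsProbe Ψ) (β : ℝ) {Θ : Fin 2 → ℝ}
    (hθ : Real.sin (Θ 0) ≠ 0) (μ ν : Fin 2) :
    4 * ((1 / (2 * Real.pi) : ℂ) * ∫ k in (-Real.pi)..Real.pi,
      star (commPart β k Θ μ *ᵥ amplitude Ψ k) ⬝ᵥ (commPart β k Θ ν *ᵥ amplitude Ψ k)) =
      (freeTerm β Θ μ ν : ℂ) := by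
  rw [freeTerm, ofReal_mul, ← intervalIntegral.integral_ofReal, mul_left_comm,
    ← intervalIntegral.integral_const_mul (4 : ℂ)]
  push_cast
  congr 1
  refine intervalIntegral.integral_congr_ae ?_
  filter_upwards [star_amplitude_dotProduct_of_isProbe hΨ] with k hk _
  rw [star_blochVec_generator_dotProduct β k hθ, trace_generator_mul_axis β k hθ, commPart,
    commPart, Matrix.smul_mulVec, Matrix.smul_mulVec, star_smul, smul_dotProduct, dotProduct_smul,
    Matrix.star_mulVec, Matrix.dotProduct_mulVec, Matrix.vecMul_vecMul, axis_conjTranspose,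
    neg_mul, axis_mul_axis, neg_smul, neg_neg, Matrix.vecMul_smul, Matrix.vecMul_one,
    smul_dotProduct, hk, star_ofReal]
  have : (-2 * (weight k Θ μ : ℂ) * -((2 * weight k Θ ν * gap k Θ : ℝ) : ℂ)) =
      ((4 * (weight k Θ μ * weight k Θ ν * gap k Θ) : ℝ) : ℂ) := by push_cast; ring
  rw [this, ofReal_re]
  simp only [smul_eq_mul]
  push_cast
  ring

theorem trace_vecMulVec_mul (φ : Fin 2 → ℂ) (V : Matrix (Fin 2) (Fin 2) ℂ) :
    (Matrix.vecMulVec φ (star φ) * V).trace = star φ ⬝ᵥ (V *ᵥ φ) := by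
  rw [Matrix.vecMulVec_mul, Matrix.trace_vecMulVec, dotProduct_comm, Matrix.dotProduct_mulVec]

/-- The factor -2 is that of ((O_μ| A |X)) = -2 `weight` Tr(X V). Two such factors make up the 4 in
`inner_sld`. -/
theorem integral_commPart_eq_stateTerm (Ψ : Walker) (β : ℝ) {Θ : Fin 2 → ℝ}
    (hθ : Real.sin (Θ 0) ≠ 0) (μ : Fin 2) :
    -2 * ((1 / (2 * Real.pi) : ℂ) * ∫ k in (-Real.pi)..Real.pi,
      star ((1 : Matrix (Fin 2) (Fin 2) ℂ) *ᵥ amplitude Ψ k) ⬝ᵥ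
        (commPart β k Θ μ *ᵥ amplitude Ψ k)) = stateTerm β Θ Ψ μ := by
  rw [stateTerm, mul_left_comm, ← intervalIntegral.integral_const_mul (-2 : ℂ)]
  congr 1
  refine intervalIntegral.integral_congr fun k _ => ?_
  rw [projState, star_blochVec_generator_dotProduct β k hθ, initialState, trace_vecMulVec_mul,
    commPart, Matrix.smul_mulVec, dotProduct_smul, smul_eq_mul, Matrix.one_mulVec, mul_assoc]

/-- The complex limit that contains both leading-order matrices, as its real and imaginary parts. -/
theorem tendsto_inner_sld_div {Ψ : Walker} (hΨ : IsProbe Ψ) (β : ℝ) {Θ : Fin 2 → ℝ}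
    (hθ : Real.sin (Θ 0) ≠ 0) {L : ℕ → Fin 2 → Op} (hL : ∀ t μ, IsSLD β Θ t Ψ μ (L t μ))
    (μ ν : Fin 2) :
    Tendsto (fun t : ℕ => (inner ℂ (L t μ (evolve β Θ t Ψ)) (L t ν (evolve β Θ t Ψ)) : ℂ) /
      ((t : ℝ) ^ 2 : ℝ)) atTop
      (𝓝 (freeTerm β Θ μ ν - star (stateTerm β Θ Ψ μ) * stateTerm β Θ Ψ ν)) := by
  have hb := continuous_meanBound β hθ
  have h2 := tendsto_integral_star_mulVec_dotProduct hΨ (continuous_meanGenerator β hθ μ)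
    (continuous_meanGenerator β hθ ν) hb (norm_meanGenerator_le β Θ μ)
    (norm_meanGenerator_le β Θ ν) (fun k => tendsto_meanGenerator β k Θ μ)
    (fun k => tendsto_meanGenerator β k Θ ν)
  have h1 := fun μ => tendsto_integral_star_mulVec_dotProduct hΨ
    (M := fun _ _ => 1) (M' := fun _ => 1) (fun _ => continuous_const)
    (continuous_meanGenerator β hθ μ) hb
    (fun _ k i j => (entry_norm_bound_of_unitary
      (one_mem (Matrix.unitaryGroup (Fin 2) ℂ)) i j).trans (one_le_meanBound β Θ k))
    (norm_meanGenerator_le β Θ μ) (fun _ => tendsto_const_nhds)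
    (fun k => tendsto_meanGenerator β k Θ μ)
  have h3 := (h2.const_mul (1 / (2 * Real.pi) : ℂ)).const_mul 4
  rw [integral_commPart_eq_freeTerm hΨ β hθ] at h3
  have h4 := fun μ => ((h1 μ).const_mul (1 / (2 * Real.pi) : ℂ)).const_mul (-2)
  simp only [integral_commPart_eq_stateTerm Ψ β hθ] at h4
  refine (h3.sub ((h4 μ).star.mul (h4 ν))).congr' ?_
  filter_upwards [eventually_ne_atTop 0] with t ht
  have ht' : (t : ℂ) ≠ 0 := by exact_mod_cast ht
  rw [inner_sld hΨ (hL t μ) (hL t ν), inner_evolveDeriv_evolveDeriv β hθ μ ν Ψ ht,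
    inner_evolve_evolveDeriv β hθ μ Ψ ht, inner_evolve_evolveDeriv β hθ ν Ψ ht]
  simp only [star_mul', star_natCast, star_neg, star_ofNat]
  push_cast
  field_simp
  ring

/-! ### Leading order of the QFI matrix and of the Uhlmann curvature -/

theorem hasLeadingQFIM_of_isProbe {Ψ : Walker} (hΨ : IsProbe Ψ) (β : ℝ) {Θ : Fin 2 → ℝ}
    (hθ : Real.sin (Θ 0) ≠ 0) :
    HasLeadingQFIM β Θ Ψ (Matrix.of fun μ ν =>
      freeTerm β Θ μ ν - (star (stateTerm β Θ Ψ μ) * stateTerm β Θ Ψ ν).re) := by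
  refine ⟨hasSLDs_of_isProbe hΨ β Θ, fun L hL μ ν => ?_⟩
  have h := (continuous_re.tendsto _).comp (tendsto_inner_sld_div hΨ β hθ hL μ ν)
  rw [sub_re, ofReal_re] at h
  refine h.congr fun t => ?_
  rw [Function.comp_apply, div_ofReal_re, qfi_eq_re (hL t μ).1 (hL t ν).1]

theorem hasLeadingUhlmann_of_isProbe {Ψ : Walker} (hΨ : IsProbe Ψ) (β : ℝ) {Θ : Fin 2 → ℝ}
    (hθ : Real.sin (Θ 0) ≠ 0) :
    HasLeadingUhlmann β Θ Ψ (Matrix.of fun μ ν =>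
      -(star (stateTerm β Θ Ψ μ) * stateTerm β Θ Ψ ν).im) := by
  refine ⟨hasSLDs_of_isProbe hΨ β Θ, fun L hL μ ν => ?_⟩
  have h := (continuous_im.tendsto _).comp (tendsto_inner_sld_div hΨ β hθ hL μ ν)
  rw [sub_im, ofReal_im, zero_sub] at h
  refine h.congr fun t => ?_
  rw [Function.comp_apply, div_ofReal_im, uhlmann_eq_im (hL t μ).1 (hL t ν).1]

/-! ### Integrals that vanish by symmetry, and compatibility. -/

theorem integral_eq_zero_of_odd_of_periodic {f : ℝ → ℝ} (hodd : ∀ x, f (-x) = -f x)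
    (hper : Function.Periodic f (2 * Real.pi)) (a : ℝ) :
    ∫ k in (-Real.pi)..Real.pi, f (k - a) = 0 := by
  rw [intervalIntegral.integral_comp_sub_right f a]
  have h1 := hper.intervalIntegral_add_eq (-Real.pi - a) (-Real.pi)
  rw [show -Real.pi - a + 2 * Real.pi = Real.pi - a by ring,
    show -Real.pi + 2 * Real.pi = Real.pi by ring] at h1
  rw [h1]
  have h2 := intervalIntegral.integral_comp_neg (a := -Real.pi) (b := Real.pi) f
  simp only [hodd, intervalIntegral.integral_neg, neg_neg] at h2
  linarith

theorem integral_eq_zero_of_antiperiodic {f : ℝ → ℂ} (hf : Function.Antiperiodic f Real.pi) :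
    ∫ k in (-Real.pi)..Real.pi, f k = 0 := by
  have h1 := hf.periodic_two_mul.intervalIntegral_add_eq (-Real.pi) 0
  have h2 := intervalIntegral.integral_comp_add_right (a := -Real.pi) (b := Real.pi) f Real.pi
  rw [show -Real.pi + 2 * Real.pi = Real.pi by ring, zero_add] at h1
  rw [neg_add_cancel, ← two_mul, ← h1] at h2
  simp only [hf _, intervalIntegral.integral_neg] at h2
  exact self_eq_neg.1 h2.symm

/-- As a function of q = k - α the integrand is a multiple of sin q cos q over an even function,
hence odd. -/
theorem freeTerm_eq_zero_of_ne (β : ℝ) {Θ : Fin 2 → ℝ} (hθ : Real.sin (Θ 0) ≠ 0) {μ ν : Fin 2}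
    (h : μ ≠ ν) : freeTerm β Θ μ ν = 0 := by
  set f : ℝ → ℝ := fun q => -(4 * (Real.sin (Θ 0) * Real.cos q) * (Real.cos (Θ 0) * Real.sin q)) /
    (1 - Real.cos (Θ 0) ^ 2 * Real.cos q ^ 2) with hf
  have hodd : ∀ q, f (-q) = -f q := fun q => by
    simp only [hf, Real.cos_neg, Real.sin_neg]; ring
  have hper : Function.Periodic f (2 * Real.pi) := fun q => by
    simp only [hf, Real.cos_add_two_pi, Real.sin_add_two_pi]
  rw [freeTerm, ← mul_zero (1 / (2 * Real.pi)),
    ← integral_eq_zero_of_odd_of_periodic hodd hper (Θ 1)]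
  congr 1
  refine intervalIntegral.integral_congr fun k _ => ?_
  have hg := (gap_pos k hθ).ne'
  have hre : (-2 * (weight k Θ μ : ℂ) * -((2 * weight k Θ ν * gap k Θ : ℝ) : ℂ)) =
      ((4 * weight k Θ μ * (weight k Θ ν * gap k Θ) : ℝ) : ℂ) := by push_cast; ring
  simp only [star_blochVec_generator_dotProduct β k hθ, trace_generator_mul_axis β k hθ, hf]
  rw [hre, ofReal_re, weight, weight, div_mul_cancel₀ _ hg, gap]
  fin_cases μ <;> fin_cases ν
  · exact absurd rfl h
  · simp only [Fin.zero_eta, Fin.mk_one, Matrix.cons_val_zero, Matrix.cons_val_one]; ring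
  · simp only [Fin.zero_eta, Fin.mk_one, Matrix.cons_val_zero, Matrix.cons_val_one]; ring
  · exact absurd rfl h

theorem hasLeadingQFIM_diagonal {Ψ : Walker} (hΨ : IsProbe Ψ) (β : ℝ) {Θ : Fin 2 → ℝ}
    (hθ : Real.sin (Θ 0) ≠ 0) (hs : ∀ μ, stateTerm β Θ Ψ μ = 0) :
    HasLeadingQFIM β Θ Ψ (Matrix.diagonal fun μ => freeTerm β Θ μ μ) := by
  convert hasLeadingQFIM_of_isProbe hΨ β hθ using 1
  ext μ ν
  rw [Matrix.of_apply, hs, hs, mul_zero, zero_re, sub_zero]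
  rcases eq_or_ne μ ν with rfl | h
  · rw [Matrix.diagonal_apply_eq]
  · rw [Matrix.diagonal_apply_ne _ h, freeTerm_eq_zero_of_ne β hθ h]

/-- Any other probe has the same state-independent diagonal, lowered by the squared modulus of its
state term. -/
theorem isCompatible_of_stateTerm_eq_zero {Ψ : Walker} (hΨ : IsProbe Ψ) (β : ℝ) {Θ : Fin 2 → ℝ}
    (hθ : Real.sin (Θ 0) ≠ 0) (hs : ∀ μ, stateTerm β Θ Ψ μ = 0) : IsCompatible β Θ Ψ := by
  refine ⟨?_, _, hasLeadingQFIM_diagonal hΨ β hθ hs, Matrix.isDiag_diagonal _, fun Φ hΦ =>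
    ⟨_, hasLeadingQFIM_of_isProbe hΦ β hθ, fun μ => ?_⟩⟩
  · convert hasLeadingUhlmann_of_isProbe hΨ β hθ using 1
    ext μ ν
    simp [hs]
  · rw [Matrix.diagonal_apply_eq, Matrix.of_apply, RCLike.star_def, ← normSq_eq_conj_mul_self,
      ofReal_re]
    exact sub_le_self _ (normSq_nonneg _)

/-- The remaining component, that of the identity, is paired with the trace of the generator, which
is 0. -/
theorem stateTerm_eq_zero_of_projState {Ψ : Walker} {β : ℝ} {Θ : Fin 2 → ℝ}
    (h : ∀ᵐ k : ℝ, ∀ i, i ≠ 0 → projState β Θ Ψ k i = 0) (μ : Fin 2) :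
    stateTerm β Θ Ψ μ = 0 := by
  rw [stateTerm, intervalIntegral.integral_congr_ae (g := fun _ => (0 : ℂ))]
  · simp
  · filter_upwards [h] with k hk _
    rw [dotProduct, Fin.sum_univ_four, hk 1 (by decide), hk 2 (by decide), hk 3 (by decide),
      Pi.star_apply, blochVec_generator_zero]
    simp

/-! ### Entangled probes -/

theorem isProbe_entangled (x₁ x₂ : ℤ) : IsProbe (entangled x₁ x₂) := by
  filter_upwards [amplitude_entangled x₁ x₂] with k hk
  have h2 : ((1 / Real.sqrt 2 : ℝ) : ℂ) * ((1 / Real.sqrt 2 : ℝ) : ℂ) = 1 / 2 := by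
    rw [← ofReal_mul, div_mul_div_comm, Real.mul_self_sqrt zero_le_two]
    push_cast
    ring
  rw [initialState, Matrix.trace_vecMulVec, hk]
  have h3 : ∀ x : ℤ, exp (-(I * (x * k))) * star (exp (-(I * (x * k)))) = 1 := fun x => by
    rw [← starRingEnd_apply, ← exp_conj, ← exp_add]
    simp
  simp only [dotProduct, Fin.sum_univ_two, Pi.smul_apply, Pi.star_apply, smul_eq_mul, star_mul',
    star_ofReal, Matrix.cons_val_zero, Matrix.cons_val_one]
  linear_combination (exp (-(I * (x₁ * k))) * star (exp (-(I * (x₁ * k)))) +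
    exp (-(I * (x₂ * k))) * star (exp (-(I * (x₂ * k))))) * h2 + (1 / 2) * h3 x₁ + (1 / 2) * h3 x₂

theorem gap_add_pi (k : ℝ) (Θ : Fin 2 → ℝ) : gap (k + Real.pi) Θ = gap k Θ := by
  rw [gap, gap, add_sub_right_comm, Real.cos_add_pi, neg_sq]

/-- This sign change is what makes the state term of the entangled probes integrate to zero. -/
theorem weight_add_pi (k : ℝ) (Θ : Fin 2 → ℝ) (μ : Fin 2) :
    weight (k + Real.pi) Θ μ = -weight k Θ μ := by
  rw [weight, weight, gap_add_pi, add_sub_right_comm, Real.cos_add_pi, Real.sin_add_pi, ← neg_div]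
  congr 1
  fin_cases μ <;> simp

/-- Both coin states have probability 1/2, so the opposite diagonal entries of V cancel. The
off-diagonal ones carry the phases ±((x₁ - x₂ - 1) k + β). For x₁ - x₂ odd these have even
frequency, hence period π in k, while `weight` is π-antiperiodic. -/
theorem stateTerm_entangled {x₁ x₂ : ℤ} (h : Odd (x₁ - x₂)) (β : ℝ) {Θ : Fin 2 → ℝ}
    (hθ : Real.sin (Θ 0) ≠ 0) (μ : Fin 2) : stateTerm β Θ (entangled x₁ x₂) μ = 0 := by
  obtain ⟨n, hn⟩ := h
  have hx : (x₁ : ℂ) = x₂ + (2 * n + 1) := by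
    rw [sub_eq_iff_eq_add'] at hn
    exact_mod_cast hn
  have h2 : ((1 / Real.sqrt 2 : ℝ) : ℂ) * ((1 / Real.sqrt 2 : ℝ) : ℂ) = 1 / 2 := by
    rw [← ofReal_mul, div_mul_div_comm, Real.mul_self_sqrt zero_le_two]
    push_cast
    ring
  -- Here 2 n = x₁ - x₂ - 1; the shift by -1 comes from the factor exp(-ik) in the off-diagonal
  -- entry of V.
  rw [stateTerm, intervalIntegral.integral_congr_ae (g := fun k : ℝ => -2 * (weight k Θ μ : ℂ) *
    (Real.sin (Θ 0) / 2 * (exp (I * (n * (2 * k) + β)) - exp (-(I * (n * (2 * k) + β))))))]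
  · rw [integral_eq_zero_of_antiperiodic, mul_zero]
    intro k
    have h1 : exp (I * (n * (2 * (k + Real.pi : ℝ)) + β)) = exp (I * (n * (2 * k) + β)) := by
      rw [exp_eq_exp_iff_exists_int]
      exact ⟨n, by push_cast; ring⟩
    simp only [weight_add_pi, exp_neg, h1]
    push_cast
    ring
  · filter_upwards [amplitude_entangled x₁ x₂] with k hk _
    rw [projState, star_blochVec_generator_dotProduct β k hθ, initialState, trace_vecMulVec_mul, hk]
    congr 1
    have hstar : ∀ x : ℤ, star (exp (-(I * (x * k)))) = exp (I * (x * k)) := fun x => by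
      rw [← starRingEnd_apply, ← exp_conj]
      simp
    have e1 : exp (I * (x₁ * k)) * exp (-(I * k)) * exp (I * β) * exp (-(I * (x₂ * k))) =
        exp (I * (n * (2 * k) + β)) := by
      rw [← exp_add, ← exp_add, ← exp_add, hx]; ring_nf
    have e2 : exp (I * (x₂ * k)) * exp (I * k) * exp (-(I * β)) * exp (-(I * (x₁ * k))) =
        exp (-(I * (n * (2 * k) + β))) := by
      rw [← exp_add, ← exp_add, ← exp_add, hx]; ring_nf
    have e3 : ∀ x : ℤ, exp (I * (x * k)) * exp (-(I * (x * k))) = 1 := fun x => by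
      rw [← exp_add]; simp
    simp only [dotProduct, Matrix.mulVec, Fin.sum_univ_two, Pi.smul_apply, Pi.star_apply,
      smul_eq_mul, star_mul', star_ofReal, Matrix.cons_val_zero, Matrix.cons_val_one, hstar, axis,
      Matrix.of_apply, Matrix.cons_val', Matrix.cons_val_fin_one]
    rw [← e1, ← e2]
    have e31 := e3 x₁
    have e32 := e3 x₂
    generalize ((1 / Real.sqrt 2 : ℝ) : ℂ) = r at *
    generalize exp (I * (x₁ * k)) = a at *
    generalize exp (-(I * (x₁ * k))) = a' at *
    generalize exp (I * (x₂ * k)) = b at *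
    generalize exp (-(I * (x₂ * k))) = b' at *
    generalize (Real.sin (k - Θ 1) : ℂ) = q
    generalize (Real.cos (Θ 0) : ℂ) = c
    generalize (Real.sin (Θ 0) : ℂ) = s
    linear_combination (s * (a * exp (-(I * k)) * exp (I * β) * b' -
      b * exp (I * k) * exp (-(I * β)) * a')) * h2 - r * r * I * c * q * e31 +
      r * r * I * c * q * e32

end QuantumWalk

end

theorem theorem2 (θ α β : ℝ) (hθ : Real.sin θ ≠ 0) :
    (∀ Ψ : QuantumWalk.Walker, QuantumWalk.IsProbe Ψ →
      (∀ μ, QuantumWalk.stateTerm β ![θ, α] Ψ μ = 0) →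
        QuantumWalk.IsCompatible β ![θ, α] Ψ ∧
        QuantumWalk.HasLeadingQFIM β ![θ, α] Ψ
          (Matrix.diagonal fun μ => QuantumWalk.freeTerm β ![θ, α] μ μ)) ∧
    (∀ Ψ : QuantumWalk.Walker, QuantumWalk.IsProbe Ψ →
      (∀ᵐ k : ℝ, ∀ i, i ≠ 0 → QuantumWalk.projState β ![θ, α] Ψ k i = 0) →
        (∀ μ, QuantumWalk.stateTerm β ![θ, α] Ψ μ = 0) ∧
        QuantumWalk.IsCompatible β ![θ, α] Ψ) ∧
    (∀ x₁ x₂ : ℤ, Odd |x₁ - x₂| →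
      QuantumWalk.IsProbe (QuantumWalk.entangled x₁ x₂) ∧
      (∀ μ, QuantumWalk.stateTerm β ![θ, α] (QuantumWalk.entangled x₁ x₂) μ = 0) ∧
      QuantumWalk.IsCompatible β ![θ, α] (QuantumWalk.entangled x₁ x₂)) := by
  have hθ' : Real.sin ((![θ, α] : Fin 2 → ℝ) 0) ≠ 0 := hθ
  refine ⟨fun Ψ hΨ hs => ⟨QuantumWalk.isCompatible_of_stateTerm_eq_zero hΨ β hθ' hs,
    QuantumWalk.hasLeadingQFIM_diagonal hΨ β hθ' hs⟩, fun Ψ hΨ h => ?_, fun x₁ x₂ hx => ?_⟩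
  · have hs := QuantumWalk.stateTerm_eq_zero_of_projState h
    exact ⟨hs, QuantumWalk.isCompatible_of_stateTerm_eq_zero hΨ β hθ' hs⟩
  · have hs := QuantumWalk.stateTerm_entangled (odd_abs.1 hx) β hθ'
    have hp := QuantumWalk.isProbe_entangled x₁ x₂
    exact ⟨hp, hs, QuantumWalk.isCompatible_of_stateTerm_eq_zero hp β hθ' hs⟩
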